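/- Let $S^1=\mathbb R/2\pi\mathbb Z$ with coordinate $\theta$, let $ST^2=\{z\in\mathbb C:|z|\le 1\}\times S^1\subset\mathbb C\times S^1$ be the solid torus with boundary $\mathbb T^2$, and let $$D=\begin{pmatrix}\frac1i\frac{\partial}{\partial\theta} & 2\frac{\partial}{\partial\bar z}\\[2pt] -2\frac{\partial}{\partial z} & -\frac1i\frac{\partial}{\partial\theta}\end{pmatrix}.$$ Let $\mathrm{dom}(D)$ be the set of all $F\in H^1(ST^2)\otimes\mathbb C^2$ for which there is $F^{ext}\in H^1_{loc}\big((\mathbb C\times S^1)\setminus ST^2\big)\otimes\mathbb C^2$ such that (1) $F^{ext}|_{\mathbb T^2}=F|_{\mathbb T^2}$ in the sense of traces, i.e. there is $w\in L^2(\mathbb T^2)\otimes\mathbb C^2$ to which the restrictions to the tori $|z|=r$ of $F$ (as $r\to1^-$) and of $F^{ext}$ (as $r\to1^+$) converge in $L^2(\mathbb T^2)$, a null set of radii being disregarded; (2) $DF^{ext}=0$; and (3) $F^{ext}\in L^2\big((\mathbb C\times S^1)\setminus ST^2\big)\otimes\mathbb C^2$. For $F\in\mathrm{dom}(D)$ write,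 with $z=re^{i\varphi}$, the Fourier decomposition $$F=\sum_{m,n\in\mathbb Z}\begin{pmatrix}f_{m,n}(r)\\ g_{m,n}(r)\end{pmatrix}e^{in\varphi+im\theta}.$$ Then every coefficient $f_{m,n}$, $g_{m,n}$ agrees for almost every $r\in(0,1)$ with a (necessarily unique) continuous function on $(0,1]$, denoted by the same symbol, and the boundary values satisfy, for all $n\in\mathbb Z$: $$|m|\,K_{n+1}(|m|)\,g_{m,n}(1)-m\,K_n(|m|)\,f_{m,n+1}(1)=0\qquad\text{for every } m\in\mathbb Z,\ m\neq0,$$ $$f_{0,n}(1)=0\ \text{ if } n\le 0,\qquad g_{0,n}(1)=0\ \text{ if } n\ge 0.$$ Here $K_n(t)=\int_0^\infty e^{-t\cosh\alpha}\cosh(n\alpha)\,d\alpha$, $t>0$, is the modified Bessel function of the second kind. -/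

import Mathlib

open scoped ContDiff ENNReal Topology
open MeasureTheory Filter Set

noncomputable section

namespace SolidTorus

/-- The circle `S¹ = ℝ / 2πℤ`, with its angular coordinate and arc length measure. -/
abbrev S1 : Type := AddCircle (2 * Real.pi)

instance instFactTwoPiPos : Fact (0 < 2 * Real.pi) := ⟨Real.two_pi_pos⟩

/-- The ambient space `ℂ × S¹`, with points `(z, θ)` and its product measure. -/
abbrev M : Type := ℂ × S1

/-- The two-dimensional torus, with angular coordinates `(φ, θ)`. -/
abbrev T2 : Type := S1 × S1

/-- The point `(r e^{iφ}, θ)` of `ℂ × S¹`; here `fourier 1 φ = e^{iφ}`. -/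
def polar (r : ℝ) (p : T2) : M := ((r : ℂ) * fourier 1 p.1, p.2)

/-- The interior of the solid torus. -/
def inside : Set M := {p | ‖p.1‖ < 1}

/-- The complement of the (closed) solid torus in `ℂ × S¹`. -/
def outside : Set M := {p | 1 < ‖p.1‖}

/-- The three coordinate directions, where `z = x + iy`. -/
inductive Coord : Type
  | x : Coord
  | y : Coord
  | θ : Coord

/-- Displacement by `t` in a coordinate direction. -/
def Coord.shift : Coord → ℝ → M
  | .x, t => ((t : ℂ), 0)
  | .y, t => ((t : ℂ) * Complex.I, 0)
  | .θ, t => (0, (t : S1))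

/-- The classical partial derivative of a function on `ℂ × S¹`. -/
def pderiv (j : Coord) (φ : M → ℂ) (p : M) : ℂ :=
  deriv (fun t : ℝ => φ (p + j.shift t)) 0

/-- Smooth functions with compact support contained in `Ω`. Smoothness is real smoothness
of the lift to `ℂ × ℝ`. -/
structure IsTestFunction (Ω : Set M) (φ : M → ℂ) : Prop where
  smooth : ContDiff ℝ ∞ (fun p : ℂ × ℝ => φ (p.1, (p.2 : S1)))
  compact : HasCompactSupport φ
  support : tsupport φ ⊆ Ω

/-- `v` is the weak partial derivative of `u` in direction `j` on the open set `Ω`. -/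
structure IsWeakPDeriv (Ω : Set M) (j : Coord) (u v : M → ℂ) : Prop where
  locInt : LocallyIntegrableOn u Ω
  locInt_deriv : LocallyIntegrableOn v Ω
  eq : ∀ φ : M → ℂ, IsTestFunction Ω φ →
    ∫ p in Ω, u p * pderiv j φ p = -∫ p in Ω, v p * φ p

/-- The space `L²(Ω)`. -/
def MemL2 (Ω : Set M) (u : M → ℂ) : Prop := MemLp u 2 (volume.restrict Ω)

/-- The space `L²_loc(Ω)`. -/
def MemL2Loc (Ω : Set M) (u : M → ℂ) : Prop := ∀ K : Set M, IsCompact K → K ⊆ Ω → MemL2 K u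

/-- The first Sobolev space `H¹(Ω)`. -/
def MemH1 (Ω : Set M) (u : M → ℂ) : Prop :=
  MemL2 Ω u ∧ ∀ j : Coord, ∃ v : M → ℂ, MemL2 Ω v ∧ IsWeakPDeriv Ω j u v

/-- The local Sobolev space `H¹_loc(Ω)`. -/
def MemH1Loc (Ω : Set M) (u : M → ℂ) : Prop :=
  MemL2Loc Ω u ∧ ∀ j : Coord, ∃ v : M → ℂ, MemL2Loc Ω v ∧ IsWeakPDeriv Ω j u v

/-- `D F = G` on `Ω`, with weak derivatives, where
`D = ((1/i) ∂/∂θ, 2 ∂/∂z̄; -2 ∂/∂z, -(1/i) ∂/∂θ)`,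
`∂/∂z̄ = (∂/∂x + i ∂/∂y) / 2` and `∂/∂z = (∂/∂x - i ∂/∂y) / 2`. -/
def IsDirac (Ω : Set M) (F G : M → ℂ × ℂ) : Prop :=
  ∃ df dg : Coord → M → ℂ,
    (∀ j, IsWeakPDeriv Ω j (fun p => (F p).1) (df j)) ∧
    (∀ j, IsWeakPDeriv Ω j (fun p => (F p).2) (dg j)) ∧
    ∀ᵐ p ∂(volume.restrict Ω),
      (G p).1 = (1 / Complex.I) * df .θ p + 2 * ((dg .x p + Complex.I * dg .y p) / 2) ∧
      (G p).2 = -2 * ((df .x p - Complex.I * df .y p) / 2) - (1 / Complex.I) * dg .θ p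

/-- `w` is the trace of `u` on the torus `r = 1`: the restrictions of `u` to the tori of
radius `r` converge to `w` in `L²` as `r → 1` from the side given by `l` (`𝓝[<] 1` or `𝓝[>] 1`).
As `u` is only defined up to null sets, a null set of radii is disregarded. -/
def IsTrace (l : Filter ℝ) (u : M → ℂ) (w : T2 → ℂ) : Prop :=
  MemLp w 2 volume ∧
    Tendsto (fun r : ℝ => eLpNorm (fun p : T2 => u (polar r p) - w p) 2 volume)
      (l ⊓ ae volume) (𝓝 0)

/-- The domain of the Dirac operator on the solid torus: the `H¹` sections having an extension
to the complement of the solid torus that is in `H¹_loc`, has the same trace on the boundary,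
solves `D F = 0` and is square integrable. -/
def diracDomain : Set (M → ℂ × ℂ) :=
  {F | MemH1 inside (fun p => (F p).1) ∧ MemH1 inside (fun p => (F p).2) ∧
    ∃ E : M → ℂ × ℂ,
      (MemH1Loc outside (fun p => (E p).1) ∧ MemH1Loc outside (fun p => (E p).2)) ∧
      (∃ w₁ w₂ : T2 → ℂ,
        (IsTrace (𝓝[<] 1) (fun p => (F p).1) w₁ ∧ IsTrace (𝓝[>] 1) (fun p => (E p).1) w₁) ∧
        (IsTrace (𝓝[<] 1) (fun p => (F p).2) w₂ ∧ IsTrace (𝓝[>] 1) (fun p => (E p).2) w₂)) ∧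
      IsDirac outside E (fun _ => 0) ∧
      (MemL2 outside (fun p => (E p).1) ∧ MemL2 outside (fun p => (E p).2))}

/-- The coefficient of `e^{inφ + imθ}` in the Fourier series of `u (r e^{iφ}, θ)`. -/
def fourierCoef (u : M → ℂ) (m n : ℤ) (r : ℝ) : ℂ :=
  (1 / (2 * Real.pi) ^ 2 : ℂ) *
    ∫ p : T2, u (polar r p) * (fourier (-n) p.1 * fourier (-m) p.2)

/-- `h` is the representative of the `(m, n)`-th Fourier coefficient of `u` which is continuous
on `(0, 1]`; the coefficient itself is only defined for almost every `r`. -/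
def IsRadialCoef (u : M → ℂ) (m n : ℤ) (h : ℝ → ℂ) : Prop :=
  ContinuousOn h (Ioc 0 1) ∧ ∀ᵐ r ∂(volume.restrict (Ioo (0 : ℝ) 1)), h r = fourierCoef u m n r

/-- The modified Bessel function of the second kind of integer order `n`, for `t > 0`. -/
def besselK (n : ℤ) (t : ℝ) : ℝ :=
  ∫ α in Ioi (0 : ℝ), Real.exp (-t * Real.cosh α) * Real.cosh (n * α)

end SolidTorus

end

open SolidTorus

/-! Outside the solid torus the equation for the extension separates. Write `G` for the coefficient
of its second component at `(m, n)` and `Φ` for that of its first component at `(m, n + 1)`. Then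
`(r⁻ⁿ G)' = -m r⁻ⁿ Φ` and `(rⁿ⁺¹ Φ)' = -m rⁿ⁺¹ G` weakly on `(1, ∞)`. Rather than solving this
system, one pairs it with a smooth solution `(α, β)` of the adjoint system `α' = m r²ⁿ⁺¹ β`, `β' = m
r⁻⁽²ⁿ⁺¹⁾ α`. The Wronskian `r⁻ⁿ G α + rⁿ⁺¹ Φ β` then has zero weak derivative, so it is a constant
`c`. If `r⁻ⁿ α` and `rⁿ⁺¹ β` are `O(√r)`, then `|c|²` is dominated by a multiple of `r (|G|² +
|Φ|²)`, which is integrable on `(1, ∞)` because the extension is square integrable; hence `c = 0`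
(`wronskian_eq_zero`).

Letting `r → 1⁺` turns this into a linear relation between Fourier coefficients of the trace
(`trace_relation`). For `m ≠ 0` the decaying adjoint solution is built from `K_{n+1}(|m| r)` and
`K_n(|m| r)`, and the relation is the asserted one. For `m = 0` the adjoint solutions are constants,
and the growth condition selects the range of `n`.

Inside, `r⁻ⁿ` times a Fourier coefficient of an `H¹` function has a weak derivative that is
integrable up to `r = 1`. This gives the continuous representative (`MemH1.exists_isRadialCoef`),
whose value at `1` is the coefficient of the same trace (`IsRadialCoef.eq_torusCoef`). -/

namespace SolidTorus

/-! ### Modified Bessel functions: derivatives, recurrences, smoothness and decay. -/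

section Bessel

/-- The integrand of `besselK`. -/
noncomputable def besselIntegrand (n : ℤ) (t α : ℝ) : ℝ :=
  Real.exp (-t * Real.cosh α) * Real.cosh (n * α)

theorem besselK_eq (n : ℤ) (t : ℝ) : besselK n t = ∫ α in Ioi (0 : ℝ), besselIntegrand n t α := rfl

theorem continuous_besselIntegrand (n : ℤ) (t : ℝ) : Continuous (besselIntegrand n t) := by
  unfold besselIntegrand
  exact (Real.continuous_exp.comp (continuous_const.mul Real.continuous_cosh)).mul
    (Real.continuous_cosh.comp (continuous_const.mul continuous_id))

/-- With `y = exp α` one has `cosh α ≥ y / 2`, and a single term of the exponential series bounds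
`exp (-t y / 2) y ^ (N + 1)`. The spare power of `y` supplies the integrable factor `exp (-α)`. -/
theorem exp_neg_mul_cosh_mul_exp_le (N : ℕ) {t : ℝ} (ht : 0 < t) (α : ℝ) :
    Real.exp (-t * Real.cosh α) * Real.exp (N * α)
      ≤ (N + 1).factorial * (2 / t) ^ (N + 1) * Real.exp (-α) := by
  set y := Real.exp α with hy
  have hy0 : 0 < y := Real.exp_pos α
  have h1 : Real.exp (-t * Real.cosh α) ≤ Real.exp (-(t * y / 2)) := by
    apply Real.exp_le_exp.2
    have : y / 2 ≤ Real.cosh α := by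
      rw [Real.cosh_eq]; have := Real.exp_pos (-α); linarith
    nlinarith
  have h2 : (t * y / 2) ^ (N + 1) / (N + 1).factorial ≤ Real.exp (t * y / 2) :=
    Real.pow_div_factorial_le_exp _ (by positivity) _
  have h3 : Real.exp (N * α) = y ^ (N + 1) * Real.exp (-α) := by
    rw [hy, ← Real.exp_nat_mul, ← Real.exp_add]; congr 1; push_cast; ring
  have hf : (0 : ℝ) < (N + 1).factorial := by positivity
  have h4 : Real.exp (-(t * y / 2)) * y ^ (N + 1) ≤ (N + 1).factorial * (2 / t) ^ (N + 1) := by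
    rw [Real.exp_neg, inv_mul_le_iff₀ (Real.exp_pos _)]
    rw [div_le_iff₀ hf] at h2
    have h5 : y ^ (N + 1) = (t * y / 2) ^ (N + 1) * (2 / t) ^ (N + 1) := by
      rw [← mul_pow]; congr 1; field_simp
    rw [h5]
    calc _ ≤ (Real.exp (t * y / 2) * (N + 1).factorial) * (2 / t) ^ (N + 1) := by gcongr
      _ = _ := by ring
  calc _ ≤ Real.exp (-(t * y / 2)) * Real.exp (N * α) := by gcongr
    _ = (Real.exp (-(t * y / 2)) * y ^ (N + 1)) * Real.exp (-α) := by rw [h3]; ring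
    _ ≤ _ := by gcongr

theorem abs_int_mul_le (n : ℤ) {α : ℝ} (hα : 0 ≤ α) : |(n : ℝ) * α| = n.natAbs * α := by
  rw [abs_mul, abs_of_nonneg hα, Nat.cast_natAbs, Int.cast_abs]

theorem cosh_int_mul_le (n : ℤ) {α : ℝ} (hα : 0 ≤ α) :
    Real.cosh (n * α) ≤ Real.exp (n.natAbs * α) := by
  rw [← abs_int_mul_le n hα, ← Real.cosh_abs]
  have h : 0 ≤ |(n : ℝ) * α| := abs_nonneg _
  have : Real.exp (-|(n : ℝ) * α|) ≤ Real.exp |(n : ℝ) * α| := Real.exp_le_exp.2 (by linarith)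
  rw [Real.cosh_eq]; linarith

theorem abs_sinh_le_cosh (x : ℝ) : |Real.sinh x| ≤ Real.cosh x := by
  rw [Real.sinh_eq, Real.cosh_eq, abs_le]
  constructor <;> have := Real.exp_pos x <;> have := Real.exp_pos (-x) <;> linarith

theorem besselIntegrand_le (n : ℤ) {t : ℝ} (ht : 0 < t) {α : ℝ} (hα : 0 ≤ α) :
    besselIntegrand n t α
      ≤ (n.natAbs + 1).factorial * (2 / t) ^ (n.natAbs + 1) * Real.exp (-α) :=
  (mul_le_mul_of_nonneg_left (cosh_int_mul_le n hα) (Real.exp_pos _).le).trans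
    (exp_neg_mul_cosh_mul_exp_le _ ht α)

theorem besselIntegrand_nonneg (n : ℤ) (t α : ℝ) : 0 ≤ besselIntegrand n t α :=
  mul_nonneg (Real.exp_pos _).le (Real.cosh_pos _).le

theorem integrableOn_besselIntegrand (n : ℤ) {t : ℝ} (ht : 0 < t) :
    IntegrableOn (besselIntegrand n t) (Ioi 0) := by
  refine Integrable.mono' ((integrableOn_exp_neg_Ioi 0).const_mul _)
    (continuous_besselIntegrand n t).aestronglyMeasurable ?_
    (g := fun α => (n.natAbs + 1).factorial * (2 / t) ^ (n.natAbs + 1) * Real.exp (-α))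
  filter_upwards [self_mem_ae_restrict measurableSet_Ioi] with α hα
  rw [Real.norm_of_nonneg (besselIntegrand_nonneg _ _ _)]
  exact besselIntegrand_le n ht (le_of_lt hα)

theorem cosh_mul_besselIntegrand (n : ℤ) (t α : ℝ) :
    Real.cosh α * besselIntegrand n t α
      = (besselIntegrand (n + 1) t α + besselIntegrand (n - 1) t α) / 2 := by
  unfold besselIntegrand
  push_cast
  rw [add_mul, sub_mul, one_mul, Real.cosh_add, Real.cosh_sub]
  ring

theorem hasDerivAt_besselK (n : ℤ) {t : ℝ} (ht : 0 < t) :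
    HasDerivAt (besselK n) (-((besselK (n + 1) t + besselK (n - 1) t) / 2)) t := by
  -- The integrand decreases in its argument, so on the neighbourhood `x > t / 2` its value at `t /
  -- 2` dominates.
  have hb : ∀ᵐ α ∂(volume.restrict (Ioi (0 : ℝ))), ∀ x ∈ Ioi (t / 2),
      ‖-(Real.cosh α * besselIntegrand n x α)‖
        ≤ Real.cosh α * besselIntegrand n (t / 2) α := by
    filter_upwards with α x hx
    rw [norm_neg, Real.norm_of_nonneg
      (mul_nonneg (Real.cosh_pos _).le (besselIntegrand_nonneg _ _ _))]
    unfold besselIntegrand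
    have := Real.cosh_pos α
    have := Real.cosh_pos (n * α)
    have hx' : t / 2 < x := hx
    gcongr
  have hi : ∀ x : ℝ, 0 < x →
      IntegrableOn (fun α => Real.cosh α * besselIntegrand n x α) (Ioi 0) := by
    intro x hx
    simp_rw [cosh_mul_besselIntegrand]
    exact ((integrableOn_besselIntegrand _ hx).add (integrableOn_besselIntegrand _ hx)).div_const 2
  have h := (hasDerivAt_integral_of_dominated_loc_of_deriv_le (μ := volume.restrict (Ioi (0 : ℝ)))
    (F := besselIntegrand n) (x₀ := t) (Ioi_mem_nhds (show t / 2 < t by linarith))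
    (F' := fun x α => -(Real.cosh α * besselIntegrand n x α))
    (Eventually.of_forall fun x => (continuous_besselIntegrand n x).aestronglyMeasurable)
    (integrableOn_besselIntegrand n ht)
    (Real.continuous_cosh.mul (continuous_besselIntegrand n t)).neg.aestronglyMeasurable
    hb (hi _ (by linarith)) ?_).2
  · convert! h using 1
    simp_rw [cosh_mul_besselIntegrand]
    rw [integral_neg, integral_div, integral_add (integrableOn_besselIntegrand _ ht)
      (integrableOn_besselIntegrand _ ht)]
    rfl
  · filter_upwards with α x _
    have h1 : HasDerivAt (fun x : ℝ => -x * Real.cosh α) (-1 * Real.cosh α) x :=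
      (hasDerivAt_id x).neg.mul_const _
    convert! h1.exp.mul_const (Real.cosh (n * α)) using 1
    unfold besselIntegrand
    ring

/-- Integrate the derivative of `exp (-t cosh α) sinh (n α)`, which vanishes at both ends of `(0,
∞)`. -/
theorem besselK_add_one_sub (n : ℤ) {t : ℝ} (ht : 0 < t) :
    t * (besselK (n + 1) t - besselK (n - 1) t) = 2 * n * besselK n t := by
  have hd : ∀ α : ℝ, HasDerivAt (fun α => Real.exp (-t * Real.cosh α) * Real.sinh (n * α))
      (n * besselIntegrand n t α
        - t / 2 * (besselIntegrand (n + 1) t α - besselIntegrand (n - 1) t α)) α := by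
    intro α
    have h1 : HasDerivAt (fun α : ℝ => (n : ℝ) * α) n α := by
      simpa using (hasDerivAt_id α).const_mul (n : ℝ)
    convert! ((Real.hasDerivAt_cosh α).const_mul (-t)).exp.mul h1.sinh using 1
    unfold besselIntegrand
    push_cast
    rw [add_mul, sub_mul, one_mul, Real.cosh_add, Real.cosh_sub]
    ring
  have hsub : IntegrableOn (fun α => besselIntegrand (n + 1) t α - besselIntegrand (n - 1) t α)
      (Ioi 0) :=
    (integrableOn_besselIntegrand (n + 1) ht).sub (integrableOn_besselIntegrand (n - 1) ht)
  have hlim : Tendsto (fun α => Real.exp (-t * Real.cosh α) * Real.sinh (n * α)) atTop (𝓝 0) := by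
    have h0 : Tendsto (fun α : ℝ => (n.natAbs + 1).factorial * (2 / t) ^ (n.natAbs + 1)
        * Real.exp (-α)) atTop (𝓝 0) := by
      simpa using Real.tendsto_exp_neg_atTop_nhds_zero.const_mul
        ((n.natAbs + 1).factorial * (2 / t) ^ (n.natAbs + 1) : ℝ)
    refine squeeze_zero_norm' ?_ h0
    filter_upwards [eventually_ge_atTop 0] with α hα
    refine le_trans ?_ (besselIntegrand_le n ht hα)
    rw [norm_mul, Real.norm_of_nonneg (Real.exp_pos _).le]
    exact mul_le_mul_of_nonneg_left (abs_sinh_le_cosh _) (Real.exp_pos _).le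
  have h := integral_Ioi_of_hasDerivAt_of_tendsto (a := 0) (hd 0).continuousAt.continuousWithinAt
    (fun x _ => hd x)
    (((integrableOn_besselIntegrand n ht).const_mul _).sub (hsub.const_mul _)) hlim
  rw [integral_sub ((integrableOn_besselIntegrand n ht).const_mul _) (hsub.const_mul _),
    integral_const_mul, integral_const_mul] at h
  have h2 := integral_sub (integrableOn_besselIntegrand (n + 1) ht)
    (integrableOn_besselIntegrand (n - 1) ht)
  rw [h2, ← besselK_eq, ← besselK_eq, ← besselK_eq] at h
  simp only [mul_zero, Real.sinh_zero, sub_zero] at h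
  linarith

/-- This and the next lemma are the ladder relations: the orders `n` and `n + 1` form a closed first
order system, as required of the pair `(α, β)`. -/
theorem hasDerivAt_besselK_sub (n : ℤ) {t : ℝ} (ht : 0 < t) :
    HasDerivAt (besselK n) (n / t * besselK n t - besselK (n + 1) t) t := by
  convert! hasDerivAt_besselK n ht using 1
  have := besselK_add_one_sub n ht
  field_simp
  linarith

theorem hasDerivAt_besselK_add_one (n : ℤ) {t : ℝ} (ht : 0 < t) :
    HasDerivAt (besselK (n + 1)) (-(n + 1) / t * besselK (n + 1) t - besselK n t) t := by
  convert! hasDerivAt_besselK (n + 1) ht using 1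
  have := besselK_add_one_sub (n + 1) ht
  rw [add_sub_cancel_right] at this ⊢
  push_cast at this
  field_simp
  linarith

/-- Differentiation only shifts the order, so the induction runs over all orders at once. Full
smoothness is needed because a test function times an adjoint solution has to be a test function
again. -/
theorem contDiffOn_besselK (n : ℤ) : ContDiffOn ℝ ∞ (besselK n) (Ioi 0) := by
  rw [contDiffOn_infty]
  intro k
  induction k generalizing n with
  | zero =>
    exact contDiffOn_zero.2 fun t ht => (hasDerivAt_besselK n ht).continuousAt.continuousWithinAt
  | succ k ih =>
    push_cast
    rw [contDiffOn_succ_iff_deriv_of_isOpen isOpen_Ioi]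
    refine ⟨fun t ht => (hasDerivAt_besselK n ht).differentiableAt.differentiableWithinAt,
      fun h => absurd h (by simp), ?_⟩
    refine (((ih (n + 1)).add (ih (n - 1))).div_const 2).neg.congr fun t ht => ?_
    exact (hasDerivAt_besselK n ht).deriv

theorem besselK_nonneg (n : ℤ) (t : ℝ) : 0 ≤ besselK n t :=
  setIntegral_nonneg measurableSet_Ioi fun α _ => besselIntegrand_nonneg n t α

/-- Since `cosh α ≥ 1`, raising the argument from `1` to `t` costs at least the factor `exp (-(t -
1))`. -/
theorem besselK_le (n : ℤ) {t : ℝ} (ht : 1 ≤ t) :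
    besselK n t ≤ besselK n 1 * Real.exp (-(t - 1)) := by
  rw [besselK_eq, besselK_eq, ← integral_mul_const]
  refine setIntegral_mono_on (integrableOn_besselIntegrand n (by linarith))
    ((integrableOn_besselIntegrand n one_pos).mul_const _) measurableSet_Ioi fun α _ => ?_
  unfold besselIntegrand
  rw [mul_right_comm, ← Real.exp_add]
  have := Real.cosh_pos (n * α)
  gcongr
  have := Real.one_le_cosh α
  nlinarith

end Bessel

/-! ### Weak derivatives on an interval. -/

section OneDim

/-- Smooth complex functions on the line with compact support contained in `I`. -/
structure IsTest (I : Set ℝ) (χ : ℝ → ℂ) : Prop where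
  smooth : ContDiff ℝ ∞ χ
  compact : HasCompactSupport χ
  support : tsupport χ ⊆ I

variable {I : Set ℝ} {χ : ℝ → ℂ}

theorem IsTest.continuous (h : IsTest I χ) : Continuous χ := h.smooth.continuous

theorem IsTest.hasDerivAt (h : IsTest I χ) (r : ℝ) : HasDerivAt χ (deriv χ r) r :=
  (h.smooth.differentiable (by simp) r).hasDerivAt

theorem IsTest.deriv (h : IsTest I χ) : IsTest I (deriv χ) where
  smooth := (contDiff_infty_iff_deriv.1 h.smooth).2
  compact := h.compact.deriv
  support := (tsupport_deriv_subset ..).trans h.support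

theorem IsTest.eq_zero (h : IsTest I χ) {r : ℝ} (hr : r ∉ I) : χ r = 0 :=
  image_eq_zero_of_notMem_tsupport fun h' => hr (h.support h')

theorem IsTest.mul_contDiffOn (h : IsTest I χ) (hI : IsOpen I) {a : ℝ → ℂ}
    (ha : ContDiffOn ℝ ∞ a I) : IsTest I (fun r => χ r * a r) := by
  have hs : tsupport (fun r => χ r * a r) ⊆ tsupport χ := tsupport_mul_subset_left
  refine ⟨contDiff_iff_contDiffAt.2 fun r => ?_, h.compact.mul_right, hs.trans h.support⟩
  by_cases hr : r ∈ tsupport χ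
  · exact h.smooth.contDiffAt.mul (ha.contDiffAt (hI.mem_nhds (h.support hr)))
  · have : (fun r => χ r * a r) =ᶠ[𝓝 r] fun _ => 0 := by
      filter_upwards [(isClosed_tsupport χ).isOpen_compl.mem_nhds hr] with x hx
      rw [image_eq_zero_of_notMem_tsupport hx, zero_mul]
    exact contDiffAt_const.congr_of_eventuallyEq this

theorem IsTest.integrableOn_mul (h : IsTest I χ) {W : ℝ → ℂ} (hW : LocallyIntegrableOn W I) :
    IntegrableOn (fun r => W r * χ r) I := by
  have h1 : IntegrableOn W (tsupport χ) :=
    hW.integrableOn_compact_subset h.support h.compact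
  have h2 : IntegrableOn (fun r => W r * χ r) (tsupport χ) :=
    h1.mul_continuousOn h.continuous.continuousOn h.compact
  exact ((integrableOn_iff_integrable_of_support_subset
    ((Function.support_mul_subset_right _ _).trans (subset_tsupport χ))).1 h2).integrableOn

/-- A compact subset of a nonempty set lies in a compact interval with endpoints in that set. -/
theorem exists_Icc_of_isCompact (hne : I.Nonempty) {K : Set ℝ}
    (hK : IsCompact K) (hKI : K ⊆ I) : ∃ a ∈ I, ∃ b ∈ I, a ≤ b ∧ K ⊆ Icc a b := by
  obtain ⟨c, hc⟩ := hne
  -- The added point covers the case of an empty `K`.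
  have hc' := hK.insert c
  have hsub : insert c K ⊆ I := insert_subset hc hKI
  have hn : (insert c K).Nonempty := insert_nonempty c K
  refine ⟨_, hsub (hc'.sInf_mem hn), _, hsub (hc'.sSup_mem hn),
    csInf_le_csSup hn hc'.bddBelow hc'.bddAbove, fun x hx => ?_⟩
  exact ⟨csInf_le hc'.bddBelow (mem_insert_of_mem _ hx),
    le_csSup hc'.bddAbove (mem_insert_of_mem _ hx)⟩

/-- The primitive from the left end of an interval containing the support vanishes beyond the right
end exactly because the total integral is zero. -/
theorem IsTest.exists_primitive (hI : I.OrdConnected) (hne : I.Nonempty)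
    {h : ℝ → ℂ} (hh : IsTest I h) (h0 : ∫ x, h x = 0) :
    ∃ χ, IsTest I χ ∧ _root_.deriv χ = h := by
  obtain ⟨a, ha, b, hb, hab, hK⟩ := exists_Icc_of_isCompact hne hh.compact hh.support
  have hd : ∀ x, HasDerivAt (fun x => ∫ t in a..x, h t) (h x) x := fun x =>
    intervalIntegral.integral_hasDerivAt_right (hh.continuous.intervalIntegrable _ _)
      (hh.continuous.stronglyMeasurableAtFilter _ _) hh.continuous.continuousAt
  have hde : _root_.deriv (fun x => ∫ t in a..x, h t) = h := funext fun x => (hd x).deriv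
  have hz : ∀ x, x ∉ Icc a b → h x = 0 := fun x hx =>
    image_eq_zero_of_notMem_tsupport fun h' => hx (hK h')
  have hsupp : Function.support (fun x => ∫ t in a..x, h t) ⊆ Icc a b := by
    intro x hx
    by_contra hx'
    apply hx
    rw [mem_Icc, not_and_or, not_le, not_le] at hx'
    rcases hx' with hx' | hx'
    · refine (intervalIntegral.integral_congr_ae (g := fun _ => 0) ?_).trans (by simp)
      have : ∀ᵐ t : ℝ, t ≠ a := by simp [ae_iff]
      filter_upwards [this] with t hta ht
      rw [uIoc_of_ge hx'.le] at ht
      exact hz t fun h' => hta (le_antisymm ht.2 h'.1)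
    · show ∫ t in a..x, h t = 0
      rw [← h0, intervalIntegral.integral_of_le (hab.trans hx'.le),
        ← integral_Icc_eq_integral_Ioc, setIntegral_eq_integral_of_forall_compl_eq_zero]
      exact fun t ht => hz t fun h' => ht ⟨h'.1, h'.2.trans hx'.le⟩
  have hts : tsupport (fun x => ∫ t in a..x, h t) ⊆ Icc a b :=
    closure_minimal hsupp isClosed_Icc
  refine ⟨_, ⟨contDiff_infty_iff_deriv.2 ⟨fun x => (hd x).differentiableAt, ?_⟩, ?_, ?_⟩, hde⟩
  · rw [hde]; exact hh.smooth
  · exact isCompact_Icc.of_isClosed_subset (isClosed_tsupport _) hts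
  · exact hts.trans (hI.out ha hb)

theorem IsTest.add {χ' : ℝ → ℂ} (h : IsTest I χ) (h' : IsTest I χ') :
    IsTest I (fun r => χ r + χ' r) where
  smooth := h.smooth.add h'.smooth
  compact := h.compact.add h'.compact
  support := (tsupport_add _ _).trans (union_subset h.support h'.support)

theorem IsTest.mul_const (h : IsTest I χ) (c : ℂ) : IsTest I (fun r => χ r * c) where
  smooth := h.smooth.mul contDiff_const
  compact := h.compact.mul_right
  support := tsupport_mul_subset_left.trans h.support

theorem exists_isTest_integral_eq_one (hI : IsOpen I) (hne : I.Nonempty) :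
    ∃ ρ, IsTest I ρ ∧ ∫ x, ρ x = 1 := by
  obtain ⟨c, hc⟩ := hne
  obtain ⟨ε, hε, hb⟩ := Metric.nhds_basis_closedBall.mem_iff.1 (hI.mem_nhds hc)
  let f : ContDiffBump c := ⟨ε / 2, ε, by positivity, by linarith⟩
  have hts : tsupport (fun x => ((f.normed volume x : ℝ) : ℂ)) ⊆ Metric.closedBall c ε := by
    refine (tsupport_comp_subset (g := ((↑) : ℝ → ℂ)) Complex.ofReal_zero _).trans ?_
    rw [f.tsupport_normed_eq]
  refine ⟨fun x => ((f.normed volume x : ℝ) : ℂ), ⟨?_, ?_, hts.trans hb⟩, ?_⟩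
  · exact Complex.ofRealCLM.contDiff.comp f.contDiff_normed
  · exact (isCompact_closedBall c ε).of_isClosed_subset (isClosed_tsupport _) hts
  · rw [integral_complex_ofReal, f.integral_normed, Complex.ofReal_one]

/-- **Du Bois-Reymond lemma**. -/
theorem ae_eq_const_of_integral_mul_deriv_eq_zero (hI : IsOpen I) (hI' : I.OrdConnected)
    (hne : I.Nonempty) {W : ℝ → ℂ} (hW : LocallyIntegrableOn W I)
    (h : ∀ χ, IsTest I χ → ∫ r in I, W r * deriv χ r = 0) :
    ∃ c, ∀ᵐ r ∂(volume.restrict I), W r = c := by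
  obtain ⟨ρ, hρ, hρ1⟩ := exists_isTest_integral_eq_one hI hne
  set c := ∫ r in I, W r * ρ r with hc
  refine ⟨c, ?_⟩
  rw [ae_restrict_iff' hI.measurableSet]
  have hWc : LocallyIntegrableOn (fun r => W r - c) I :=
    hW.sub ((locallyIntegrable_const c).locallyIntegrableOn I)
  have key := hI.ae_eq_zero_of_integral_contDiff_smul_eq_zero hWc ?_
  · filter_upwards [key] with r hr hrI
    exact sub_eq_zero.1 (hr hrI)
  intro g hg hgc hgs
  have hφ : IsTest I (fun r => (g r : ℂ)) :=
    ⟨Complex.ofRealCLM.contDiff.comp hg, hgc.comp_left Complex.ofReal_zero,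
      (tsupport_comp_subset (g := ((↑) : ℝ → ℂ)) Complex.ofReal_zero _).trans hgs⟩
  have hint : ∀ {η : ℝ → ℂ}, IsTest I η → Integrable η := fun hη =>
    hη.continuous.integrable_of_hasCompactSupport hη.compact
  -- Subtracting `(∫ g) ρ` from `g` leaves a function of mean zero, hence the derivative of a test
  -- function.
  obtain ⟨χ, hχ, hχd⟩ := IsTest.exists_primitive hI' hne
    (hφ.add (hρ.mul_const (-∫ r, (g r : ℂ)))) (by
      rw [integral_add (hint hφ) ((hint hρ).mul_const _), integral_mul_const, hρ1]; ring)
  have h1 := h χ hχ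
  simp_rw [hχd, mul_add, ← mul_assoc] at h1
  rw [integral_add (hφ.integrableOn_mul hW) ((hρ.integrableOn_mul hW).mul_const _),
    integral_mul_const, ← hc] at h1
  rw [← setIntegral_eq_integral_of_forall_compl_eq_zero (s := I)]
  · have : ∀ r, g r • (W r - c) = W r * (g r : ℂ) - c * (g r : ℂ) := fun r => by
      rw [Complex.real_smul]; ring
    simp_rw [this]
    rw [integral_sub (hφ.integrableOn_mul hW) ((hint hφ).integrableOn.const_mul _),
      integral_const_mul,
      setIntegral_eq_integral_of_forall_compl_eq_zero (fun r hr => hφ.eq_zero hr)]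
    linear_combination h1
  · intro r hr
    rw [Complex.real_smul, hφ.eq_zero hr, zero_mul]

/-- Fubini on the triangle `r < s`. As `V` need not be integrable near `a`, the left end is first
moved to a point `α` below the support of `χ`. There is no boundary term at `b`, where the primitive
vanishes. -/
theorem integral_primitive_mul_deriv {a b : ℝ} {V : ℝ → ℂ}
    (hV : ∀ r ∈ Ioo a b, IntegrableOn V (Ioo r b)) (hχ : IsTest (Ioo a b) χ) :
    ∫ r in Ioo a b, (∫ s in r..b, V s) * deriv χ r = ∫ s in Ioo a b, V s * χ s := by
  rcases (Ioo a b).eq_empty_or_nonempty with he | hne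
  · simp [he]
  obtain ⟨α', hα', β, hβ, -, hK⟩ :=
    exists_Icc_of_isCompact hne hχ.compact hχ.support
  obtain ⟨α, hα1, hα2⟩ := exists_between hα'.1
  have hαb : α < b := hα2.trans hα'.2
  have hsub : Ioo α b ⊆ Ioo a b := Ioo_subset_Ioo_left hα1.le
  have hχ' : IsTest (Ioo α b) χ :=
    ⟨hχ.smooth, hχ.compact, hK.trans fun x hx => ⟨hα2.trans_le hx.1, hx.2.trans_lt hβ.2⟩⟩
  have hVα := hV α ⟨hα1, hαb⟩
  rw [setIntegral_eq_of_subset_of_forall_sdiff_eq_zero measurableSet_Ioo hsub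
      (fun r hr => by rw [hχ'.deriv.eq_zero hr.2, mul_zero]),
    setIntegral_eq_of_subset_of_forall_sdiff_eq_zero measurableSet_Ioo hsub
      (fun r hr => by rw [hχ'.eq_zero hr.2, mul_zero])]
  let G : ℝ → ℝ → ℂ := fun r s => {p : ℝ × ℝ | p.1 < p.2}.indicator
    (fun p => deriv χ p.1 * V p.2) (r, s)
  have hG : Integrable (Function.uncurry G)
      ((volume.restrict (Ioo α b)).prod (volume.restrict (Ioo α b))) := by
    have h1 : Integrable (deriv χ) (volume.restrict (Ioo α b)) :=
      (hχ.deriv.continuous.integrable_of_hasCompactSupport hχ.deriv.compact).integrableOn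
    exact (h1.mul_prod hVα).indicator (measurableSet_lt measurable_fst measurable_snd)
  have hswap := integral_integral_swap hG
  have hl : ∫ r in Ioo α b, (∫ s in r..b, V s) * deriv χ r
      = ∫ r in Ioo α b, ∫ s in Ioo α b, G r s := by
    refine setIntegral_congr_fun measurableSet_Ioo fun r hr => ?_
    have : ∀ s, G r s = (Ioi r).indicator (fun s => deriv χ r * V s) s := fun s => by
      simp only [G, indicator, mem_ofPred_eq, mem_Ioi]
    simp_rw [this]
    rw [setIntegral_indicator measurableSet_Ioi, integral_const_mul, mul_comm,
      intervalIntegral.integral_of_le hr.2.le, integral_Ioc_eq_integral_Ioo]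
    congr 3
    ext s
    simp only [mem_Ioo, mem_inter_iff, mem_Ioi]
    exact ⟨fun h => ⟨⟨hr.1.trans h.1, h.2⟩, h.1⟩, fun h => ⟨h.2, h.1.2⟩⟩
  have hr : ∫ s in Ioo α b, V s * χ s = ∫ s in Ioo α b, ∫ r in Ioo α b, G r s := by
    refine setIntegral_congr_fun measurableSet_Ioo fun s hs => ?_
    have : ∀ r, G r s = (Iio s).indicator (fun r => deriv χ r * V s) r := fun r => by
      simp only [G, indicator, mem_ofPred_eq, mem_Iio]
    simp_rw [this]
    rw [setIntegral_indicator measurableSet_Iio, integral_mul_const]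
    have h2 : Ioo α b ∩ Iio s = Ioo α s := by
      ext r
      simp only [mem_Ioo, mem_inter_iff, mem_Iio]
      exact ⟨fun h => ⟨h.1.1, h.2⟩, fun h => ⟨⟨h.1, h.2.trans hs.2⟩, h.2⟩⟩
    rw [h2, ← integral_Ioc_eq_integral_Ioo, ← intervalIntegral.integral_of_le hs.1.le,
      intervalIntegral.integral_deriv_eq_sub' _ rfl
        (fun x _ => (hχ.hasDerivAt x).differentiableAt) hχ.deriv.continuous.continuousOn,
      hχ'.eq_zero (r := α) (by simp), sub_zero, mul_comm]
  rw [hl, hr, hswap]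

/-- A function with a weak derivative that is integrable near the right endpoint agrees almost
everywhere with a function continuous up to that endpoint. -/
theorem exists_continuousOn_of_weak_deriv {a b : ℝ} (hab : a < b) {W V : ℝ → ℂ}
    (hW : LocallyIntegrableOn W (Ioo a b)) (hV : ∀ r ∈ Ioo a b, IntegrableOn V (Ioo r b))
    (h : ∀ χ, IsTest (Ioo a b) χ →
      ∫ r in Ioo a b, W r * deriv χ r = -∫ r in Ioo a b, V r * χ r) :
    ∃ H : ℝ → ℂ, ContinuousOn H (Ioc a b) ∧ ∀ᵐ r ∂(volume.restrict (Ioo a b)), H r = W r := by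
  have hc : ContinuousOn (fun r => ∫ s in r..b, V s) (Ioc a b) := by
    intro r hr
    obtain ⟨α, hα1, hα2⟩ := exists_between hr.1
    have hαb : α < b := hα2.trans_le hr.2
    have h1 : IntegrableOn V (uIcc α b) := by
      rw [uIcc_of_le hαb.le, integrableOn_Icc_iff_integrableOn_Ioo]
      exact hV α ⟨hα1, hαb⟩
    have h2 := intervalIntegral.continuousOn_primitive_interval_left h1
    rw [uIcc_of_le hαb.le] at h2
    refine (h2 r ⟨hα2.le, hr.2⟩).mono_of_mem_nhdsWithin ?_
    filter_upwards [self_mem_nhdsWithin, mem_nhdsWithin_of_mem_nhds (Ioi_mem_nhds hα2)] with x hx hx'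
    exact ⟨le_of_lt hx', hx.2⟩
  have hcl : LocallyIntegrableOn (fun r => ∫ s in r..b, V s) (Ioo a b) :=
    (hc.mono Ioo_subset_Ioc_self).locallyIntegrableOn measurableSet_Ioo
  have hVl : LocallyIntegrableOn V (Ioo a b) := by
    intro x hx
    obtain ⟨α, hα1, hα2⟩ := exists_between hx.1
    exact ⟨Ioo α b, mem_nhdsWithin_of_mem_nhds (Ioo_mem_nhds hα2 hx.2),
      hV α ⟨hα1, hα2.trans hx.2⟩⟩
  -- The primitive `∫ s in r..b, V s` has weak derivative `-V`, so adding it to `W` leaves a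
  -- function with zero weak derivative.
  obtain ⟨c, hcc⟩ := ae_eq_const_of_integral_mul_deriv_eq_zero isOpen_Ioo ordConnected_Ioo
    (nonempty_Ioo.2 hab) (hW.add hcl) (fun χ hχ => by
      have h1 := h χ hχ
      rw [← integral_primitive_mul_deriv hV hχ] at h1
      simp only [Pi.add_apply, add_mul]
      rw [integral_add (hχ.deriv.integrableOn_mul hW) (hχ.deriv.integrableOn_mul hcl), h1]
      ring)
  refine ⟨fun r => c - ∫ s in r..b, V s, continuousOn_const.sub hc, ?_⟩
  filter_upwards [hcc] with r hr
  rw [← hr]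
  simp

end OneDim

/-! ### Polar coordinates and Fourier coefficients on the torus. -/

section Polar

/-- The set of points of `ℂ × S¹` whose distance to the core circle lies in `J`. -/
def annulus (J : Set ℝ) : Set M := {p | ‖p.1‖ ∈ J}

/-- The measure `r dr` on `J`. -/
noncomputable def radialMeasure (J : Set ℝ) : Measure ℝ :=
  (volume.restrict J).withDensity fun r => ENNReal.ofReal r

instance (J : Set ℝ) : SFinite (radialMeasure J) := by
  unfold radialMeasure; infer_instance

theorem norm_fourier (n : ℤ) (φ : S1) : ‖fourier n φ‖ = 1 := Circle.norm_coe _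

theorem norm_polar_fst (r : ℝ) (p : T2) : ‖(polar r p).1‖ = |r| := by
  unfold polar
  rw [norm_mul, norm_fourier, mul_one, Complex.norm_real, Real.norm_eq_abs]

theorem continuous_polar : Continuous fun q : ℝ × T2 => polar q.1 q.2 := by
  unfold polar
  fun_prop

theorem lintegral_complex_eq_polar {f : ℂ → ℝ≥0∞} (hf : Measurable f) :
    ∫⁻ z, f z = ∫⁻ r, ∫⁻ φ : S1, f (r * fourier 1 φ) ∂volume ∂(radialMeasure (Ioi 0)) := by
  have hm : Measurable fun q : ℝ × S1 => f (q.1 * fourier 1 q.2) :=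
    hf.comp (by fun_prop : Continuous fun q : ℝ × S1 => (q.1 : ℂ) * fourier 1 q.2).measurable
  rw [← Complex.lintegral_comp_polarCoord_symm, polarCoord_target, Measure.volume_eq_prod,
    ← Measure.prod_restrict, lintegral_prod _ (by
      have : Continuous fun p : ℝ × ℝ => Complex.polarCoord.symm p := by
        simp_rw [Complex.polarCoord_symm_apply]; fun_prop
      exact ((ENNReal.measurable_ofReal.comp measurable_fst).mul
        (hf.comp this.measurable)).aemeasurable)]
  unfold radialMeasure
  rw [lintegral_withDensity_eq_lintegral_mul _ ENNReal.measurable_ofReal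
    (Measurable.lintegral_prod_right' hm)]
  refine lintegral_congr fun r => ?_
  simp only [smul_eq_mul, Pi.mul_apply]
  rw [lintegral_const_mul']
  · congr 1
    rw [← AddCircle.lintegral_preimage (2 * Real.pi) (-Real.pi), restrict_Ioo_eq_restrict_Ioc]
    have : -Real.pi + 2 * Real.pi = Real.pi := by ring
    rw [this]
    refine lintegral_congr fun φ => ?_
    congr 1
    rw [Complex.polarCoord_symm_apply, fourier_coe_apply, Complex.ofReal_cos, Complex.ofReal_sin,
      ← Complex.exp_mul_I]
    congr 2
    push_cast
    field_simp
  · exact ENNReal.ofReal_ne_top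

theorem measurePreserving_polar_complex :
    MeasurePreserving (fun q : ℝ × S1 => (q.1 : ℂ) * fourier 1 q.2)
      ((radialMeasure (Ioi 0)).prod volume) volume := by
  have hm : Measurable fun q : ℝ × S1 => (q.1 : ℂ) * fourier 1 q.2 :=
    (by fun_prop : Continuous fun q : ℝ × S1 => (q.1 : ℂ) * fourier 1 q.2).measurable
  refine ⟨hm, Measure.ext fun s hs => ?_⟩
  rw [Measure.map_apply hm hs, Measure.prod_apply (hm hs), ← lintegral_indicator_one hs,
    lintegral_complex_eq_polar (measurable_one.indicator hs)]
  refine lintegral_congr fun r => ?_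
  rw [← lintegral_indicator_one (measurable_prodMk_left (hm hs))]
  rfl

theorem measurePreserving_polar :
    MeasurePreserving (fun q : ℝ × T2 => polar q.1 q.2)
      ((radialMeasure (Ioi 0)).prod volume) volume :=
  (measurePreserving_polar_complex.prod (MeasurePreserving.id (volume : Measure S1))).comp
    (measurePreserving_prodAssoc (radialMeasure (Ioi 0)) (volume : Measure S1)
      (volume : Measure S1)).symm

variable {J : Set ℝ}

theorem measurableSet_annulus (hJ : MeasurableSet J) : MeasurableSet (annulus J) :=
  (by fun_prop : Continuous fun p : M => ‖p.1‖).measurable hJ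

theorem measurePreserving_polar_annulus (hJ : MeasurableSet J) (h0 : J ⊆ Ioi 0) :
    MeasurePreserving (fun q : ℝ × T2 => polar q.1 q.2)
      ((radialMeasure J).prod volume) (volume.restrict (annulus J)) := by
  have h := measurePreserving_polar.restrict_preimage (measurableSet_annulus hJ)
  convert! h using 1
  have h1 : radialMeasure J = (radialMeasure (Ioi 0)).restrict J := by
    unfold radialMeasure
    rw [restrict_withDensity hJ, Measure.restrict_restrict hJ, inter_eq_left.2 h0]
  have h2 : radialMeasure (Ioi 0) = (radialMeasure (Ioi 0)).restrict (Ioi 0) := by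
    unfold radialMeasure
    rw [restrict_withDensity measurableSet_Ioi, Measure.restrict_restrict measurableSet_Ioi,
      inter_self]
  -- The preimage of the annulus also contains the negative `r` with `|r| ∈ J`; the radial measure
  -- does not charge them.
  have h3 : (radialMeasure (Ioi 0)).prod (volume : Measure T2)
      = ((radialMeasure (Ioi 0)).prod volume).restrict (Ioi 0 ×ˢ univ) := by
    conv_lhs => rw [h2, ← Measure.restrict_univ (μ := (volume : Measure T2)), Measure.prod_restrict]
  rw [h1]
  conv_lhs => rw [← Measure.restrict_univ (μ := (volume : Measure T2)), Measure.prod_restrict]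
  rw [h3, Measure.restrict_restrict (hJ.prod .univ), Measure.restrict_restrict
    (continuous_polar.measurable (measurableSet_annulus hJ))]
  congr 1
  ext q
  simp only [mem_inter_iff, mem_prod, mem_univ, and_true, mem_Ioi, mem_preimage, annulus,
    mem_ofPred_eq, norm_polar_fst]
  constructor
  · rintro ⟨h, h'⟩
    rw [abs_of_pos h']; exact ⟨h, h'⟩
  · rintro ⟨h, h'⟩
    rw [abs_of_pos h'] at h; exact ⟨h, h'⟩

theorem ae_radialMeasure_iff (hJ : MeasurableSet J) (h0 : J ⊆ Ioi 0) {P : ℝ → Prop} :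
    (∀ᵐ r ∂(radialMeasure J), P r) ↔ ∀ᵐ r ∂(volume.restrict J), P r := by
  unfold radialMeasure
  rw [ae_withDensity_iff ENNReal.measurable_ofReal]
  refine ⟨fun h => ?_, fun h => h.mono fun r hr _ => hr⟩
  filter_upwards [h, self_mem_ae_restrict hJ] with r hr hrJ
  exact hr (by simpa using h0 hrJ)

theorem integrable_radialMeasure_iff (hJ : MeasurableSet J) (h0 : J ⊆ Ioi 0) {f : ℝ → ℂ} :
    Integrable f (radialMeasure J) ↔ IntegrableOn (fun r : ℝ => (r : ℂ) * f r) J := by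
  unfold radialMeasure
  rw [integrable_withDensity_iff_integrable_smul' ENNReal.measurable_ofReal (by simp)]
  refine integrable_congr ?_
  filter_upwards [self_mem_ae_restrict hJ] with r hr
  rw [ENNReal.toReal_ofReal (le_of_lt (h0 hr)), Complex.real_smul]

theorem integral_radialMeasure (hJ : MeasurableSet J) (h0 : J ⊆ Ioi 0) (f : ℝ → ℂ) :
    ∫ r, f r ∂(radialMeasure J) = ∫ r in J, (r : ℂ) * f r := by
  unfold radialMeasure
  rw [integral_withDensity_eq_integral_toReal_smul ENNReal.measurable_ofReal (by simp)]
  refine setIntegral_congr_fun hJ fun r hr => ?_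
  rw [ENNReal.toReal_ofReal (le_of_lt (h0 hr)), Complex.real_smul]

/-- The character `e^{-inφ - imθ}` of the torus. -/
noncomputable def torusChar (m n : ℤ) (p : T2) : ℂ := fourier (-n) p.1 * fourier (-m) p.2

theorem continuous_torusChar (m n : ℤ) : Continuous (torusChar m n) := by
  unfold torusChar; fun_prop

theorem norm_torusChar (m n : ℤ) (p : T2) : ‖torusChar m n p‖ = 1 := by
  rw [torusChar, norm_mul, norm_fourier, norm_fourier, mul_one]

/-- The coefficient of `e^{inφ + imθ}` in the Fourier series of a function on the torus. -/
noncomputable def torusCoef (m n : ℤ) (w : T2 → ℂ) : ℂ :=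
  (1 / (2 * Real.pi) ^ 2 : ℂ) * ∫ p : T2, w p * torusChar m n p

theorem fourierCoef_eq (u : M → ℂ) (m n : ℤ) (r : ℝ) :
    fourierCoef u m n r = torusCoef m n (fun p => u (polar r p)) := rfl

theorem Integrable.mul_torusChar {w : T2 → ℂ} (hw : Integrable w) (m n : ℤ) :
    Integrable fun p => w p * torusChar m n p :=
  hw.mul_bdd (c := 1) (continuous_torusChar m n).aestronglyMeasurable
    (ae_of_all _ fun p => (norm_torusChar m n p).le)

theorem torusCoef_sub {w w' : T2 → ℂ} (hw : Integrable w) (hw' : Integrable w') (m n : ℤ) :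
    torusCoef m n (fun p => w p - w' p) = torusCoef m n w - torusCoef m n w' := by
  unfold torusCoef
  simp_rw [sub_mul]
  rw [integral_sub (Integrable.mul_torusChar hw m n) (Integrable.mul_torusChar hw' m n), mul_sub]

/-- A bound for the Fourier coefficients of a function of unit `L²` norm. -/
noncomputable def torusCoefBound : ℝ≥0∞ :=
  ‖(1 / (2 * Real.pi) ^ 2 : ℂ)‖ₑ * (volume (univ : Set T2)) ^ (1 / 2 : ℝ)

theorem torusCoefBound_ne_top : torusCoefBound ≠ ⊤ :=
  ENNReal.mul_ne_top enorm_ne_top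
    (ENNReal.rpow_ne_top_of_nonneg (by norm_num) (measure_ne_top _ _))

/-- Characters have modulus one, and on a space of finite measure the `L¹` norm is controlled by the
`L²` norm. -/
theorem enorm_torusCoef_le {w : T2 → ℂ} (hw : AEStronglyMeasurable w) (m n : ℤ) :
    ‖torusCoef m n w‖ₑ ≤ torusCoefBound * eLpNorm w 2 := by
  unfold torusCoef torusCoefBound
  rw [enorm_mul, mul_assoc]
  gcongr
  calc ‖∫ p : T2, w p * torusChar m n p‖ₑ ≤ ∫⁻ p, ‖w p * torusChar m n p‖ₑ :=
        enorm_integral_le_lintegral_enorm _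
    _ = eLpNorm w 1 := by
        rw [eLpNorm_one_eq_lintegral_enorm]
        refine lintegral_congr fun p => ?_
        rw [enorm_mul, ← ofReal_norm (torusChar m n p), norm_torusChar, ENNReal.ofReal_one, mul_one]
    _ ≤ _ := by
        have := eLpNorm_le_eLpNorm_mul_rpow_measure_univ (p := 1) (q := 2) (by norm_num) hw
        rw [mul_comm (eLpNorm w 2 volume)] at this
        convert! this using 3
        norm_num

variable {u : M → ℂ}

theorem integrable_comp_polar (hJ : MeasurableSet J) (h0 : J ⊆ Ioi 0)
    (hu : IntegrableOn u (annulus J)) :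
    Integrable (fun q : ℝ × T2 => u (polar q.1 q.2)) ((radialMeasure J).prod volume) :=
  (measurePreserving_polar_annulus hJ h0).integrable_comp_of_integrable hu

theorem integral_annulus (hJ : MeasurableSet J) (h0 : J ⊆ Ioi 0)
    (hu : IntegrableOn u (annulus J)) :
    ∫ p in annulus J, u p = ∫ r in J, (r : ℂ) * ∫ p, u (polar r p) := by
  have hmp := measurePreserving_polar_annulus hJ h0
  rw [← hmp.map_eq, integral_map hmp.measurable.aemeasurable (by
      rw [hmp.map_eq]; exact hu.aestronglyMeasurable),
    integral_prod _ (integrable_comp_polar hJ h0 hu), integral_radialMeasure hJ h0]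

/-- Pairing with a function separated in polar coordinates is an integral over a Fourier
coefficient. -/
theorem integral_annulus_mul (hJ : MeasurableSet J) (h0 : J ⊆ Ioi 0) {ψ : M → ℂ} {c : ℝ → ℂ}
    {m n : ℤ} (hψ : ∀ r ∈ J, ∀ p, ψ (polar r p) = c r * torusChar m n p)
    (hu : IntegrableOn (fun p => u p * ψ p) (annulus J)) :
    ∫ p in annulus J, u p * ψ p
      = (2 * Real.pi) ^ 2 * ∫ r in J, (r : ℂ) * fourierCoef u m n r * c r := by
  rw [integral_annulus hJ h0 hu, ← integral_const_mul]
  refine setIntegral_congr_fun hJ fun r hr => ?_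
  simp only [hψ r hr, fourierCoef_eq, torusCoef]
  have : ∀ p, u (polar r p) * (c r * torusChar m n p)
      = c r * (u (polar r p) * torusChar m n p) := fun p => by ring
  simp_rw [this]
  rw [integral_const_mul]
  have := Real.pi_ne_zero
  have h2 : (Real.pi : ℂ) ≠ 0 := by exact_mod_cast this
  field_simp

theorem integrableOn_mul_fourierCoef (hJ : MeasurableSet J) (h0 : J ⊆ Ioi 0)
    (hu : IntegrableOn u (annulus J)) (m n : ℤ) :
    IntegrableOn (fun r : ℝ => (r : ℂ) * fourierCoef u m n r) J := by
  rw [← integrable_radialMeasure_iff hJ h0]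
  have h1 : Integrable (fun q : ℝ × T2 => u (polar q.1 q.2) * torusChar m n q.2)
      ((radialMeasure J).prod volume) :=
    (integrable_comp_polar hJ h0 hu).mul_bdd (c := 1)
      ((continuous_torusChar m n).comp continuous_snd).aestronglyMeasurable
      (ae_of_all _ fun p => (norm_torusChar m n p.2).le)
  exact h1.integral_prod_left.const_mul _

theorem isCompact_annulus {a b : ℝ} : IsCompact (annulus (Icc a b)) := by
  have h1 : IsCompact {p : M | ‖p.1‖ ≤ b} := by
    have : {p : M | ‖p.1‖ ≤ b} = Metric.closedBall (0 : ℂ) b ×ˢ (univ : Set S1) := by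
      ext p; simp
    rw [this]
    exact (isCompact_closedBall 0 b).prod isCompact_univ
  refine h1.of_isClosed_subset ?_ fun p hp => hp.2
  exact isClosed_Icc.preimage (by fun_prop : Continuous fun p : M => ‖p.1‖)

theorem locallyIntegrableOn_fourierCoef (hJ : IsOpen J) (h0 : J ⊆ Ioi 0)
    (hu : LocallyIntegrableOn u (annulus J)) (m n : ℤ) :
    LocallyIntegrableOn (fourierCoef u m n) J := by
  intro x hx
  obtain ⟨ε, hε, hb⟩ := Metric.nhds_basis_closedBall.mem_iff.1 (hJ.mem_nhds hx)
  rw [Real.closedBall_eq_Icc] at hb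
  refine ⟨Icc (x - ε) (x + ε), mem_nhdsWithin_of_mem_nhds (Icc_mem_nhds (by linarith)
    (by linarith)), ?_⟩
  have h1 := integrableOn_mul_fourierCoef measurableSet_Icc (hb.trans h0)
    (hu.integrableOn_compact_subset (fun p hp => hb hp) isCompact_annulus) m n
  have h2 : IntegrableOn (fun r : ℝ => (r : ℂ)⁻¹ * ((r : ℂ) * fourierCoef u m n r))
      (Icc (x - ε) (x + ε)) := by
    refine h1.continuousOn_mul ?_ isCompact_Icc
    refine ContinuousOn.inv₀ (by fun_prop) fun r hr => ?_
    exact_mod_cast (h0 (hb hr)).ne'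
  refine h2.congr_fun (fun r hr => ?_) measurableSet_Icc
  have : (r : ℂ) ≠ 0 := by exact_mod_cast (h0 (hb hr)).ne'
  simp only
  field_simp

theorem ae_aestronglyMeasurable_comp_polar (hJ : MeasurableSet J) (h0 : J ⊆ Ioi 0)
    (hu : AEStronglyMeasurable u (volume.restrict (annulus J))) :
    ∀ᵐ r ∂(volume.restrict J), AEStronglyMeasurable fun p => u (polar r p) := by
  rw [← ae_radialMeasure_iff hJ h0]
  exact (hu.comp_measurePreserving (measurePreserving_polar_annulus hJ h0)).prodMk_left

/-- `enorm_torusCoef_le` is applied on almost every torus, then squared and integrated against `r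
dr`. -/
theorem memLp_fourierCoef (hJ : MeasurableSet J) (h0 : J ⊆ Ioi 0)
    (hu : MemL2 (annulus J) u) (m n : ℤ) :
    MemLp (fourierCoef u m n) 2 (radialMeasure J) := by
  have hmp := measurePreserving_polar_annulus hJ h0
  have hc : MemLp (fun q : ℝ × T2 => u (polar q.1 q.2)) 2 ((radialMeasure J).prod volume) :=
    hu.comp_measurePreserving hmp
  have hm : AEStronglyMeasurable (fourierCoef u m n) (radialMeasure J) := by
    have h1 : AEStronglyMeasurable (fun q : ℝ × T2 => u (polar q.1 q.2) * torusChar m n q.2)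
        ((radialMeasure J).prod volume) :=
      hc.1.mul ((continuous_torusChar m n).comp continuous_snd).aestronglyMeasurable
    exact h1.integral_prod_right'.const_mul _
  refine ⟨hm, ?_⟩
  rw [eLpNorm_lt_top_iff_lintegral_rpow_enorm_lt_top (by norm_num) (by norm_num)]
  have h2 := hc.2
  rw [eLpNorm_lt_top_iff_lintegral_rpow_enorm_lt_top (by norm_num) (by norm_num),
    lintegral_prod _ (hc.1.enorm.pow_const _)] at h2
  have hb : ∀ᵐ r ∂(radialMeasure J), ‖fourierCoef u m n r‖ₑ ^ (2 : ℝ≥0∞).toReal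
      ≤ torusCoefBound ^ 2 * ∫⁻ p, ‖u (polar r p)‖ₑ ^ (2 : ℝ≥0∞).toReal := by
    rw [ae_radialMeasure_iff hJ h0]
    filter_upwards [ae_aestronglyMeasurable_comp_polar hJ h0 hu.1] with r hr
    have h3 := enorm_torusCoef_le hr m n
    rw [eLpNorm_eq_lintegral_rpow_enorm_toReal (by norm_num) (by norm_num)] at h3
    calc _ ≤ (torusCoefBound * (∫⁻ p, ‖u (polar r p)‖ₑ ^ (2 : ℝ≥0∞).toReal)
          ^ (1 / (2 : ℝ≥0∞).toReal)) ^ (2 : ℝ≥0∞).toReal := by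
          rw [fourierCoef_eq]; gcongr
      _ = _ := by
          rw [ENNReal.mul_rpow_of_nonneg _ _ (by norm_num), ← ENNReal.rpow_mul]
          norm_num
  refine (lintegral_mono_ae hb).trans_lt ?_
  rw [lintegral_const_mul' _ _ (ENNReal.pow_ne_top torusCoefBound_ne_top)]
  exact ENNReal.mul_lt_top (ENNReal.pow_ne_top torusCoefBound_ne_top).lt_top h2

theorem integrableOn_mul_norm_sq_fourierCoef (hJ : MeasurableSet J) (h0 : J ⊆ Ioi 0)
    (hu : MemL2 (annulus J) u) (m n : ℤ) :
    IntegrableOn (fun r => r * ‖fourierCoef u m n r‖ ^ 2) J := by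
  have h := (memLp_fourierCoef hJ h0 hu m n).integrable_norm_pow (p := 2) (by norm_num)
  unfold radialMeasure at h
  rw [integrable_withDensity_iff_integrable_smul' ENNReal.measurable_ofReal (by simp)] at h
  refine h.congr ?_
  filter_upwards [self_mem_ae_restrict hJ] with r hr
  rw [ENNReal.toReal_ofReal (le_of_lt (h0 hr)), smul_eq_mul]

/-- The Fourier coefficients of a function converge to those of its trace. -/
theorem tendsto_fourierCoef_of_isTrace {l : Filter ℝ} {w : T2 → ℂ} (hJ : MeasurableSet J)
    (h0 : J ⊆ Ioi 0) (hl : J ∈ l)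
    (hu : AEStronglyMeasurable u (volume.restrict (annulus J))) (hw : IsTrace l u w) (m n : ℤ) :
    Tendsto (fourierCoef u m n) (l ⊓ ae volume) (𝓝 (torusCoef m n w)) := by
  have h1 : ∀ᶠ r in l ⊓ ae (volume : Measure ℝ), AEStronglyMeasurable fun p => u (polar r p) := by
    have h := ae_aestronglyMeasurable_comp_polar hJ h0 hu
    rw [ae_restrict_iff' hJ] at h
    filter_upwards [mem_inf_of_left hl, mem_inf_of_right h] with r hr hr'
    exact hr' hr
  -- Any finite bound would do: it puts the difference in `L²`, so the restriction of `u` is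
  -- integrable, as `torusCoef_sub` requires.
  have h2 : ∀ᶠ r in l ⊓ ae (volume : Measure ℝ),
      eLpNorm (fun p : T2 => u (polar r p) - w p) 2 volume < 1 :=
    hw.2.eventually (Iio_mem_nhds zero_lt_one)
  rw [tendsto_iff_edist_tendsto_0]
  have h3 : Tendsto (fun r => torusCoefBound * eLpNorm (fun p : T2 => u (polar r p) - w p) 2)
      (l ⊓ ae volume) (𝓝 0) := by
    have := ENNReal.Tendsto.const_mul hw.2 (Or.inr torusCoefBound_ne_top)
    rwa [mul_zero] at this
  refine tendsto_of_tendsto_of_tendsto_of_le_of_le' tendsto_const_nhds h3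
    (Eventually.of_forall fun _ => zero_le) ?_
  filter_upwards [h1, h2] with r hr hr2
  have hd : MemLp (fun p : T2 => u (polar r p) - w p) 2 :=
    ⟨hr.sub hw.1.1, hr2.trans ENNReal.one_lt_top⟩
  have hwi : Integrable w := hw.1.integrable (by norm_num)
  have hui : Integrable fun p => u (polar r p) := by
    have := (hd.integrable (by norm_num)).add hwi
    refine this.congr (ae_of_all _ fun p => ?_)
    simp
  rw [edist_eq_enorm_sub, fourierCoef_eq, ← torusCoef_sub hui hwi]
  exact enorm_torusCoef_le hd.1 m n

end Polar

/-! ### Test functions on `ℂ × S¹` that separate in polar coordinates. -/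

section TestFunctions

/-- The lift of a point of the plane and an angle to `ℂ × S¹`. -/
noncomputable def liftPoint (p : ℂ × ℝ) : M := (p.1, (p.2 : S1))

theorem isOpenQuotientMap_liftPoint : IsOpenQuotientMap liftPoint :=
  IsOpenQuotientMap.id.prodMap QuotientAddGroup.isOpenQuotientMap_mk

variable {Ω Ω' : Set M} {φ u v : M → ℂ}

theorem IsTestFunction.continuous (h : IsTestFunction Ω φ) : Continuous φ :=
  isOpenQuotientMap_liftPoint.isQuotientMap.continuous_iff.2 h.smooth.continuous

/-- The coordinate directions upstairs in `ℂ × ℝ`. -/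
def Coord.dir : Coord → ℂ × ℝ
  | .x => (1, 0)
  | .y => (Complex.I, 0)
  | .θ => (0, 1)

theorem liftPoint_add_smul_dir (j : Coord) (p : ℂ × ℝ) (t : ℝ) :
    liftPoint (p + t • j.dir) = liftPoint p + j.shift t := by
  cases j <;> simp [liftPoint, Coord.dir, Coord.shift]

theorem IsTestFunction.hasDerivAt (h : IsTestFunction Ω φ) (j : Coord) (p : ℂ × ℝ) :
    HasDerivAt (fun t : ℝ => φ (liftPoint p + j.shift t))
      (fderiv ℝ (fun p => φ (liftPoint p)) p j.dir) 0 := by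
  have h1 : HasDerivAt (fun t : ℝ => p + t • j.dir) j.dir 0 := by
    simpa using ((hasDerivAt_id (0 : ℝ)).smul_const j.dir).const_add p
  have h2 : HasFDerivAt (fun p => φ (liftPoint p)) (fderiv ℝ (fun p => φ (liftPoint p)) p)
      (p + (0 : ℝ) • j.dir) := by
    rw [zero_smul, add_zero]
    exact (h.smooth.differentiable (by simp) p).hasFDerivAt
  have h3 := h2.comp_hasDerivAt (0 : ℝ) h1
  refine h3.congr_of_eventuallyEq (Eventually.of_forall fun t => ?_)
  simp [liftPoint_add_smul_dir]

theorem IsTestFunction.continuous_pderiv (h : IsTestFunction Ω φ) (j : Coord) :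
    Continuous (pderiv j φ) := by
  refine isOpenQuotientMap_liftPoint.isQuotientMap.continuous_iff.2 ?_
  have : pderiv j φ ∘ liftPoint = fun p => fderiv ℝ (fun p => φ (liftPoint p)) p j.dir :=
    funext fun p => (h.hasDerivAt j p).deriv
  rw [this]
  exact (h.smooth.continuous_fderiv (by simp)).clm_apply continuous_const

theorem continuous_shift (j : Coord) : Continuous j.shift := by
  cases j
  · exact (by fun_prop : Continuous fun t : ℝ => (((t : ℂ), 0) : M))
  · exact (by fun_prop : Continuous fun t : ℝ => (((t : ℂ) * Complex.I, 0) : M))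
  · exact (Continuous.prodMk continuous_const (AddCircle.continuous_mk' _) :
      Continuous fun t : ℝ => ((0, (t : S1)) : M))

theorem shift_zero (j : Coord) : j.shift 0 = 0 := by
  cases j <;> simp [Coord.shift]

theorem pderiv_eq_zero (j : Coord) {p : M} (hp : p ∉ tsupport φ) : pderiv j φ p = 0 := by
  have h1 : Tendsto (fun t : ℝ => p + j.shift t) (𝓝 0) (𝓝 p) := by
    have hc : Continuous fun t : ℝ => p + j.shift t := continuous_const.add (continuous_shift j)
    have := hc.tendsto 0
    simpa only [shift_zero, add_zero] using this
  have h2 : (fun t : ℝ => φ (p + j.shift t)) =ᶠ[𝓝 0] fun _ => 0 := by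
    filter_upwards [h1 ((isClosed_tsupport φ).isOpen_compl.mem_nhds hp)] with t ht
    exact image_eq_zero_of_notMem_tsupport ht
  exact h2.deriv_eq.trans (deriv_const _ _)

theorem integrableOn_mul_of_compact (hu : LocallyIntegrableOn u Ω) {K : Set M} (hK : IsCompact K)
    (hKΩ : K ⊆ Ω) (hφ : Continuous φ) (h0 : ∀ p ∉ K, φ p = 0) :
    IntegrableOn (fun p => u p * φ p) Ω := by
  have h2 : IntegrableOn (fun p => u p * φ p) K :=
    (hu.integrableOn_compact_subset hKΩ hK).mul_continuousOn hφ.continuousOn hK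
  refine ((integrableOn_iff_integrable_of_support_subset fun p hp => ?_).1 h2).integrableOn
  by_contra hpK
  exact hp (by simp [h0 p hpK])

theorem IsTestFunction.integrableOn_mul (h : IsTestFunction Ω φ) (hu : LocallyIntegrableOn u Ω) :
    IntegrableOn (fun p => u p * φ p) Ω :=
  integrableOn_mul_of_compact hu h.compact h.support h.continuous
    fun _ hp => image_eq_zero_of_notMem_tsupport hp

theorem IsTestFunction.integrableOn_mul_pderiv (h : IsTestFunction Ω φ)
    (hu : LocallyIntegrableOn u Ω) (j : Coord) :
    IntegrableOn (fun p => u p * pderiv j φ p) Ω :=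
  integrableOn_mul_of_compact hu h.compact h.support (h.continuous_pderiv j)
    fun _ hp => pderiv_eq_zero j hp

theorem IsTestFunction.mono (h : IsTestFunction Ω φ) (hs : Ω ⊆ Ω') : IsTestFunction Ω' φ :=
  ⟨h.smooth, h.compact, h.support.trans hs⟩

theorem IsWeakPDeriv.mono {j : Coord} (h : IsWeakPDeriv Ω' j u v) (hs : Ω ⊆ Ω')
    (hm' : MeasurableSet Ω') : IsWeakPDeriv Ω j u v where
  locInt := h.locInt.mono_set hs
  locInt_deriv := h.locInt_deriv.mono_set hs
  eq φ hφ := by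
    have := h.eq φ (hφ.mono hs)
    rwa [setIntegral_eq_of_subset_of_forall_sdiff_eq_zero hm' hs (fun p hp => by
        rw [pderiv_eq_zero _ fun h' => hp.2 (hφ.support h'), mul_zero]),
      setIntegral_eq_of_subset_of_forall_sdiff_eq_zero hm' hs (fun p hp => by
        rw [image_eq_zero_of_notMem_tsupport fun h' => hp.2 (hφ.support h'), mul_zero])] at this

/-- The map `x + iy ↦ x + iεy`; it is the identity for `ε = 1` and conjugation for `ε = -1`. -/
noncomputable def reflect (ε : ℤ) (z : ℂ) : ℂ := z.re + ε * Complex.I * z.im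

/-- The function `χ(|z|) L(z)⁻ᵏ e^{-imθ}` with `L = reflect ε`. -/
noncomputable def radialTest (ε m k : ℤ) (χ : ℝ → ℂ) (p : M) : ℂ :=
  χ ‖p.1‖ * reflect ε p.1 ^ (-k) * fourier (-m) p.2

variable {ε m k : ℤ} {J : Set ℝ} {χ : ℝ → ℂ}

theorem norm_reflect (hε : ε = 1 ∨ ε = -1) (z : ℂ) : ‖reflect ε z‖ = ‖z‖ := by
  rw [Complex.norm_eq_sqrt_sq_add_sq, Complex.norm_eq_sqrt_sq_add_sq z]
  rcases hε with rfl | rfl <;> simp [reflect]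

theorem reflect_ne_zero (hε : ε = 1 ∨ ε = -1) {z : ℂ} (hz : z ≠ 0) : reflect ε z ≠ 0 := by
  rw [← norm_ne_zero_iff, norm_reflect hε, norm_ne_zero_iff]; exact hz

theorem contDiff_reflect : ContDiff ℝ ∞ (reflect ε) := by
  have h1 : ContDiff ℝ ∞ fun z : ℂ => (z.re : ℂ) :=
    (Complex.ofRealCLM.comp Complex.reCLM).contDiff
  have h2 : ContDiff ℝ ∞ fun z : ℂ => (z.im : ℂ) :=
    (Complex.ofRealCLM.comp Complex.imCLM).contDiff
  exact h1.add (contDiff_const.mul h2)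

theorem contDiff_fourier (n : ℤ) : ContDiff ℝ ∞ fun s : ℝ => fourier n (s : S1) := by
  simp_rw [fourier_coe_apply]
  exact Complex.contDiff_exp.comp ((contDiff_const.mul Complex.ofRealCLM.contDiff).div_const _)

theorem tsupport_radialTest_subset :
    tsupport (radialTest ε m k χ) ⊆ {p : M | ‖p.1‖ ∈ tsupport χ} := by
  refine closure_minimal (fun p hp => ?_)
    ((isClosed_tsupport χ).preimage (by fun_prop : Continuous fun p : M => ‖p.1‖))
  by_contra h
  apply hp
  have : ‖p.1‖ ∉ tsupport χ := h
  rw [radialTest, image_eq_zero_of_notMem_tsupport this, zero_mul, zero_mul]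

/-- Neither `|z|` nor negative powers are smooth at `z = 0`, but the support stays away from the
core circle because `J ⊆ Ioi 0`. -/
theorem isTestFunction_radialTest (hε : ε = 1 ∨ ε = -1) (h0 : J ⊆ Ioi 0) (hχ : IsTest J χ) :
    IsTestFunction (annulus J) (radialTest ε m k χ) where
  smooth := by
    refine contDiff_iff_contDiffAt.2 fun p => ?_
    by_cases hp : ‖p.1‖ ∈ tsupport χ
    · have hp0 : p.1 ≠ 0 := norm_pos_iff.1 (h0 (hχ.support hp))
      have h1 : ContDiffAt ℝ ∞ (fun p : ℂ × ℝ => χ ‖p.1‖) p :=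
        hχ.smooth.contDiffAt.comp p ((contDiffAt_norm ℝ hp0).comp p contDiffAt_fst)
      have h2 : ContDiffAt ℝ ∞ (fun z : ℂ => z ^ (-k)) (reflect ε p.1) :=
        ContDiffAt.restrict_scalars ℝ (𝕜' := ℂ)
          (((analyticAt_id (𝕜 := ℂ)).zpow (reflect_ne_zero hε hp0)).contDiffAt)
      have h3 : ContDiffAt ℝ ∞ (fun p : ℂ × ℝ => reflect ε p.1 ^ (-k)) p :=
        h2.comp (f := fun p : ℂ × ℝ => reflect ε p.1) p (contDiff_reflect.contDiffAt.comp p contDiffAt_fst)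
      have h4 : ContDiffAt ℝ ∞ (fun p : ℂ × ℝ => fourier (-m) (p.2 : S1)) p :=
        (contDiff_fourier (-m)).contDiffAt.comp p contDiffAt_snd
      exact (h1.mul h3).mul h4
    · have hop : IsOpen {q : ℂ × ℝ | ‖q.1‖ ∈ (tsupport χ)ᶜ} :=
        (isClosed_tsupport χ).isOpen_compl.preimage
          (by fun_prop : Continuous fun q : ℂ × ℝ => ‖q.1‖)
      refine (contDiffAt_const (c := (0 : ℂ))).congr_of_eventuallyEq ?_
      filter_upwards [hop.mem_nhds hp] with q hq
      have : ‖q.1‖ ∉ tsupport χ := hq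
      rw [radialTest, image_eq_zero_of_notMem_tsupport this, zero_mul, zero_mul]
  compact := by
    obtain ⟨b, hb⟩ := hχ.compact.bddAbove
    refine (isCompact_annulus (a := 0) (b := b)).of_isClosed_subset (isClosed_tsupport _) ?_
    exact fun p hp => ⟨norm_nonneg _, hb (tsupport_radialTest_subset hp)⟩
  support := fun _ hp => hχ.support (tsupport_radialTest_subset hp)

theorem reflect_real_mul_fourier (hε : ε = 1 ∨ ε = -1) (r : ℝ) (φ : S1) :
    reflect ε (r * fourier 1 φ) = r * fourier ε φ := by
  rcases hε with rfl | rfl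
  · have : ∀ z : ℂ, reflect 1 z = z := fun z => by
      simp only [reflect, Int.cast_one, one_mul]
      rw [mul_comm, Complex.re_add_im]
    exact this _
  · have : ∀ z : ℂ, reflect (-1) z = (starRingEnd ℂ) z := fun z => by
      apply Complex.ext <;> simp [reflect]
    rw [this, map_mul, Complex.conj_ofReal, fourier_neg]

theorem fourier_zpow (n k : ℤ) (φ : S1) : (fourier n φ : ℂ) ^ k = fourier (k * n) φ := by
  simp only [fourier_apply, mul_zsmul, AddCircle.toCircle_zsmul, Circle.coe_zpow]

theorem radialTest_polar (hε : ε = 1 ∨ ε = -1) {r : ℝ} (hr : 0 < r) (p : T2) :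
    radialTest ε m k χ (polar r p) = χ r * (r : ℂ) ^ (-k) * torusChar m (ε * k) p := by
  rw [radialTest, norm_polar_fst, abs_of_pos hr]
  simp only [polar, torusChar]
  rw [reflect_real_mul_fourier hε, mul_zpow, fourier_zpow]
  rw [show -k * ε = -(ε * k) by ring]
  ring

theorem hasDerivAt_reflect_zpow (hε : ε = 1 ∨ ε = -1) {z e : ℂ} (hz : z ≠ 0) :
    HasDerivAt (fun t : ℝ => reflect ε (z + t * e) ^ (-k))
      (((-k : ℤ) : ℂ) * reflect ε z ^ (-k - 1) * reflect ε e) 0 := by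
  have h1 : HasDerivAt (fun t : ℝ => reflect ε (z + t * e)) (reflect ε e) 0 := by
    have : (fun t : ℝ => reflect ε (z + t * e))
        = fun t : ℝ => reflect ε z + (t : ℂ) * reflect ε e := by
      funext t
      simp [reflect]
      ring
    rw [this]
    simpa using ((Complex.ofRealCLM.hasDerivAt (x := (0 : ℝ))).mul_const (reflect ε e)).const_add
      (reflect ε z)
  have h2 := hasDerivAt_zpow (-k) (reflect ε (z + ((0 : ℝ) : ℂ) * e))
    (Or.inl (reflect_ne_zero hε (by simpa using hz)))
  have h3 := HasDerivAt.comp (0 : ℝ) h2 h1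
  convert! h3 using 3
  simp

theorem hasDerivAt_norm_add {z e : ℂ} (hz : z ≠ 0) :
    HasDerivAt (fun t : ℝ => ‖z + t * e‖) ((z.re * e.re + z.im * e.im) / ‖z‖) 0 := by
  have hne : z.re ^ 2 + z.im ^ 2 ≠ 0 := by
    have := Complex.sq_norm z
    rw [Complex.normSq_apply] at this
    have h : ‖z‖ ^ 2 ≠ 0 := pow_ne_zero _ (norm_ne_zero_iff.2 hz)
    rw [this] at h
    convert h using 1
    ring
  have h1 : HasDerivAt (fun t : ℝ => (z.re + t * e.re) ^ 2 + (z.im + t * e.im) ^ 2)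
      (2 * (z.re * e.re + z.im * e.im)) 0 := by
    have h2 := (((hasDerivAt_id (0 : ℝ)).mul_const e.re).const_add z.re).pow 2
    have h3 := (((hasDerivAt_id (0 : ℝ)).mul_const e.im).const_add z.im).pow 2
    convert! h2.add h3 using 1
    simp
    ring
  have h4 := h1.sqrt (by simpa using hne)
  have : (fun t : ℝ => ‖z + t * e‖)
      = fun t : ℝ => √((z.re + t * e.re) ^ 2 + (z.im + t * e.im) ^ 2) := by
    funext t
    rw [Complex.norm_eq_sqrt_sq_add_sq]
    simp
  rw [this]
  convert! h4 using 1
  rw [Complex.norm_eq_sqrt_sq_add_sq z]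
  simp only [zero_mul, add_zero]
  rw [mul_div_mul_left _ _ two_ne_zero]

theorem hasDerivAt_radialTest (hε : ε = 1 ∨ ε = -1) (hχ : IsTest J χ) {z : ℂ} (e : ℂ) (θ : S1)
    (hz : z ≠ 0) :
    HasDerivAt (fun t : ℝ => radialTest ε m k χ (z + t * e, θ))
      ((((z.re * e.re + z.im * e.im) / ‖z‖ : ℝ) * deriv χ ‖z‖ * reflect ε z ^ (-k)
        + χ ‖z‖ * (((-k : ℤ) : ℂ) * reflect ε z ^ (-k - 1) * reflect ε e)) * fourier (-m) θ) 0 := by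
  have h1 : HasDerivAt χ (deriv χ ‖z‖) (‖z + ((0 : ℝ) : ℂ) * e‖) := by
    simpa using hχ.hasDerivAt ‖z‖
  have h2 := HasDerivAt.scomp (0 : ℝ) h1 (hasDerivAt_norm_add (e := e) hz)
  have h3 := (h2.mul (hasDerivAt_reflect_zpow (k := k) (e := e) hε hz)).mul_const (fourier (-m) θ)
  convert! h3 using 1
  simp [Complex.real_smul]

/-- For `ε = 1` the operator is `2 ∂/∂z̄`, which kills `z⁻ᵏ` and sends `χ(|z|)` to `χ'(|z|) z /
|z|`; the factor `z` lowers `k` by one. For `ε = -1` everything is conjugated. The two signs serve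
the two rows of the Dirac operator. -/
theorem pderiv_radialTest_add (hε : ε = 1 ∨ ε = -1) (hχ : IsTest J χ) {p : M} (hp : p.1 ≠ 0) :
    pderiv .x (radialTest ε m k χ) p + ε * Complex.I * pderiv .y (radialTest ε m k χ) p
      = radialTest ε m (k - 1) (fun r => deriv χ r * (r : ℂ)⁻¹) p := by
  obtain ⟨z, θ⟩ := p
  have hx := (hasDerivAt_radialTest (m := m) (k := k) hε hχ 1 θ hp).deriv
  have hy := (hasDerivAt_radialTest (m := m) (k := k) hε hχ Complex.I θ hp).deriv
  simp only [mul_one] at hx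
  have hz : reflect ε z ≠ 0 := reflect_ne_zero hε hp
  have hn : (‖z‖ : ℂ) ≠ 0 := by exact_mod_cast norm_ne_zero_iff.2 hp
  simp only [pderiv, Coord.shift, Prod.mk_add_mk, add_zero]
  rw [hx, hy]
  have e1 : reflect ε 1 = 1 := by simp [reflect]
  have e2 : reflect ε Complex.I = ε * Complex.I := by simp [reflect]
  -- This identity makes the terms cancel in which the power of `reflect ε z` is differentiated.
  have e3 : (ε : ℂ) * Complex.I * (ε * Complex.I) = -1 := by
    rcases hε with rfl | rfl <;> simp
  have e4 : reflect ε z ^ (-(k - 1)) = reflect ε z ^ (-k) * reflect ε z := by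
    rw [← zpow_add_one₀ hz]; congr 1; ring
  simp only [radialTest, e1, e2, e4, Complex.one_re, Complex.one_im, Complex.I_re, Complex.I_im,
    mul_one, mul_zero, add_zero, zero_add]
  push_cast
  have e6 : reflect ε z ^ (-k) * reflect ε z = reflect ε z ^ (-k) * (z.re + ε * Complex.I * z.im) :=
    rfl
  rw [e6]
  field_simp
  linear_combination (-χ ‖z‖ * k * reflect ε z ^ (-k - 1) * ‖z‖) * e3

theorem pderiv_θ_radialTest (p : M) :
    pderiv .θ (radialTest ε m k χ) p = -(m * Complex.I) * radialTest ε m k χ p := by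
  obtain ⟨z, θ⟩ := p
  induction θ using QuotientAddGroup.induction_on with
  | H s =>
    have h1 := hasDerivAt_fourier (2 * Real.pi) (-m) s
    rw [← add_zero s] at h1
    have h2 := HasDerivAt.comp_const_add s 0 h1
    have h3 := (h2.const_mul (χ ‖z‖ * reflect ε z ^ (-k))).deriv
    rw [add_zero] at h3
    refine Eq.trans ?_ (h3.trans ?_)
    · simp only [pderiv, Coord.shift, Prod.mk_add_mk, add_zero, radialTest, AddCircle.coe_add]
    have hpi : (Real.pi : ℂ) ≠ 0 := by exact_mod_cast Real.pi_ne_zero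
    simp only [radialTest]
    push_cast
    field_simp

end TestFunctions

/-! ### Weak radial equations for Fourier coefficients, and boundary values from inside. -/

section Weak

variable {J : Set ℝ} {χ : ℝ → ℂ} {u vx vy w wθ : M → ℂ} {ε : ℤ}

/-- The weak form of `(∂ₓ + iε∂_y) u = vx + iε vy`, tested against a separated function. -/
theorem integral_fourierCoef_mul_deriv (hJ : IsOpen J) (h0 : J ⊆ Ioi 0) (hε : ε = 1 ∨ ε = -1)
    (hx : IsWeakPDeriv (annulus J) .x u vx) (hy : IsWeakPDeriv (annulus J) .y u vy)
    (hχ : IsTest J χ) (m n : ℤ) :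
    (2 * Real.pi) ^ 2 * ∫ r in J, fourierCoef u m (ε * n) r * (r : ℂ) ^ (-n) * deriv χ r
      = -∫ p in annulus J, (vx p + ε * Complex.I * vy p) * radialTest ε m (n + 1) χ p := by
  have hψ := isTestFunction_radialTest (m := m) (k := n + 1) hε h0 hχ
  have hd : ∀ p ∈ annulus J, u p * pderiv .x (radialTest ε m (n + 1) χ) p
      + ε * Complex.I * (u p * pderiv .y (radialTest ε m (n + 1) χ) p)
      = u p * radialTest ε m n (fun r => deriv χ r * (r : ℂ)⁻¹) p := fun p hp => by
    have h := pderiv_radialTest_add (m := m) (k := n + 1) hε hχ (p := p) (norm_pos_iff.1 (h0 hp))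
    rw [add_sub_cancel_right] at h
    rw [← h]; ring
  have hxi := hψ.integrableOn_mul_pderiv hx.locInt .x
  have hyi := hψ.integrableOn_mul_pderiv hy.locInt .y
  have hms := measurableSet_annulus hJ.measurableSet
  have hint : IntegrableOn (fun p => u p * radialTest ε m n (fun r => deriv χ r * (r : ℂ)⁻¹) p)
      (annulus J) :=
    (hxi.add (hyi.const_mul (ε * Complex.I))).congr_fun hd hms
  have hpolar : ∀ r ∈ J, ∀ p, radialTest ε m n (fun r => deriv χ r * (r : ℂ)⁻¹) (polar r p)
      = deriv χ r * (r : ℂ)⁻¹ * (r : ℂ) ^ (-n) * torusChar m (ε * n) p := fun r hr p => by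
    rw [radialTest_polar hε (h0 hr)]
  have h1 := integral_annulus_mul hJ.measurableSet h0 hpolar hint
  -- The factor `r⁻¹` left by differentiating the test function cancels the Jacobian `r`.
  have h2 : ∫ r in J, fourierCoef u m (ε * n) r * (r : ℂ) ^ (-n) * deriv χ r
      = ∫ r in J, (r : ℂ) * fourierCoef u m (ε * n) r
        * (deriv χ r * (r : ℂ)⁻¹ * (r : ℂ) ^ (-n)) := by
    refine setIntegral_congr_fun hJ.measurableSet fun r hr => ?_
    have : (r : ℂ) ≠ 0 := by exact_mod_cast (h0 hr).ne'
    field_simp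
  rw [h2, ← h1, ← setIntegral_congr_fun hms hd,
    integral_add hxi (hyi.const_mul (ε * Complex.I)), integral_const_mul, hx.eq _ hψ, hy.eq _ hψ]
  simp_rw [add_mul, mul_assoc]
  rw [integral_add (hψ.integrableOn_mul hx.locInt_deriv)
    (((hψ.integrableOn_mul hy.locInt_deriv).const_mul _).const_mul _), integral_const_mul,
    integral_const_mul]
  ring

/-- Pairing with a separated test function is an integral over a Fourier coefficient. -/
theorem integral_mul_radialTest (hJ : IsOpen J) (h0 : J ⊆ Ioi 0) (hε : ε = 1 ∨ ε = -1)
    (hw : LocallyIntegrableOn w (annulus J)) (hχ : IsTest J χ) (m n : ℤ) :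
    ∫ p in annulus J, w p * radialTest ε m (n + 1) χ p
      = (2 * Real.pi) ^ 2
        * ∫ r in J, fourierCoef w m (ε * (n + 1)) r * (r : ℂ) ^ (-n) * χ r := by
  have hψ := isTestFunction_radialTest (m := m) (k := n + 1) hε h0 hχ
  rw [integral_annulus_mul hJ.measurableSet h0
    (fun r hr p => radialTest_polar (m := m) (k := n + 1) hε (h0 hr) p) (hψ.integrableOn_mul hw)]
  congr 1
  refine setIntegral_congr_fun hJ.measurableSet fun r hr => ?_
  have hr0 : (r : ℂ) ≠ 0 := by exact_mod_cast (h0 hr).ne'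
  -- Here the Jacobian is not cancelled; it turns `r⁻⁽ⁿ⁺¹⁾` into `r⁻ⁿ`, so both sides of the radial
  -- equation carry the same power.
  have : (r : ℂ) ^ (-n) = (r : ℂ) ^ (-(n + 1)) * r := by
    rw [← zpow_add_one₀ hr0]; congr 1; ring
  simp only [this]
  ring

theorem two_pi_sq_ne_zero : ((2 * Real.pi) ^ 2 : ℂ) ≠ 0 := by
  have : (Real.pi : ℂ) ≠ 0 := by exact_mod_cast Real.pi_ne_zero
  exact pow_ne_zero _ (mul_ne_zero two_ne_zero this)

theorem weak_deriv_fourierCoef (hJ : IsOpen J) (h0 : J ⊆ Ioi 0) (hε : ε = 1 ∨ ε = -1)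
    (hx : IsWeakPDeriv (annulus J) .x u vx) (hy : IsWeakPDeriv (annulus J) .y u vy)
    (hχ : IsTest J χ) (m n : ℤ) :
    ∫ r in J, fourierCoef u m (ε * n) r * (r : ℂ) ^ (-n) * deriv χ r
      = -∫ r in J, fourierCoef (fun p => vx p + ε * Complex.I * vy p) m (ε * (n + 1)) r
          * (r : ℂ) ^ (-n) * χ r := by
  have hv : LocallyIntegrableOn (fun p => vx p + ε * Complex.I * vy p) (annulus J) :=
    hx.locInt_deriv.add (hy.locInt_deriv.smul (ε * Complex.I))
  have h := integral_fourierCoef_mul_deriv hJ h0 hε hx hy hχ m n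
  rw [integral_mul_radialTest hJ h0 hε hv hχ, ← mul_neg] at h
  exact mul_left_cancel₀ two_pi_sq_ne_zero h

/-- The weak form of `(∂ₓ + iε∂_y) u = i ∂_θ w` for the Fourier coefficients. -/
theorem weak_deriv_fourierCoef_of_dirac (hJ : IsOpen J) (h0 : J ⊆ Ioi 0) (hε : ε = 1 ∨ ε = -1)
    (hx : IsWeakPDeriv (annulus J) .x u vx) (hy : IsWeakPDeriv (annulus J) .y u vy)
    (hθ : IsWeakPDeriv (annulus J) .θ w wθ)
    (h : ∀ᵐ p ∂(volume.restrict (annulus J)), vx p + ε * Complex.I * vy p = Complex.I * wθ p)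
    (hχ : IsTest J χ) (m n : ℤ) :
    ∫ r in J, fourierCoef u m (ε * n) r * (r : ℂ) ^ (-n) * deriv χ r
      = m * ∫ r in J, fourierCoef w m (ε * (n + 1)) r * (r : ℂ) ^ (-n) * χ r := by
  have hψ := isTestFunction_radialTest (m := m) (k := n + 1) hε h0 hχ
  have h1 := integral_fourierCoef_mul_deriv hJ h0 hε hx hy hχ m n
  have h2 : ∫ p in annulus J, (vx p + ε * Complex.I * vy p) * radialTest ε m (n + 1) χ p
      = Complex.I * ∫ p in annulus J, wθ p * radialTest ε m (n + 1) χ p := by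
    rw [← integral_const_mul]
    refine integral_congr_ae ?_
    filter_upwards [h] with p hp
    rw [hp]; ring
  have h3 : ∫ p in annulus J, w p * pderiv .θ (radialTest ε m (n + 1) χ) p
      = -(m * Complex.I) * ∫ p in annulus J, w p * radialTest ε m (n + 1) χ p := by
    rw [← integral_const_mul]
    refine integral_congr_ae (ae_of_all _ fun p => ?_)
    simp only [pderiv_θ_radialTest]
    ring
  have h4 := hθ.eq _ hψ
  rw [h3, integral_mul_radialTest hJ h0 hε hθ.locInt hχ] at h4
  rw [h2] at h1
  refine mul_left_cancel₀ two_pi_sq_ne_zero ?_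
  rw [h1]
  linear_combination -Complex.I * h4 - (2 * Real.pi) ^ 2 * m
    * (∫ r in J, fourierCoef w m (ε * (n + 1)) r * (r : ℂ) ^ (-n) * χ r) * Complex.I_sq

theorem continuousOn_zpow_ofReal (h0 : J ⊆ Ioi 0) (k : ℤ) :
    ContinuousOn (fun r : ℝ => (r : ℂ) ^ k) J := by
  refine ContinuousOn.zpow₀ (by fun_prop) k fun r hr => Or.inl ?_
  exact_mod_cast (h0 hr).ne'

theorem volume_inside_lt_top : volume inside < ⊤ := by
  refine (measure_mono ?_).trans_lt (isCompact_annulus (a := 0) (b := 1)).measure_lt_top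
  exact fun p hp => ⟨norm_nonneg _, le_of_lt hp⟩

theorem MemL2.integrableOn_inside (hu : MemL2 inside u) : IntegrableOn u inside := by
  have : IsFiniteMeasure (volume.restrict inside) := ⟨by
    rw [Measure.restrict_apply_univ]; exact volume_inside_lt_top⟩
  exact MemLp.integrable (by norm_num) hu

theorem annulus_Ioo_subset_inside : annulus (Ioo 0 1) ⊆ inside := fun _ hp => hp.2

theorem measurableSet_inside : MeasurableSet inside :=
  measurableSet_annulus (J := Iio 1) measurableSet_Iio

/-- By `weak_deriv_fourierCoef`, `r⁻ⁿ` times the coefficient has as weak derivative `r⁻ⁿ` times a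
coefficient of `(∂ₓ + i∂_y) u`. Away from `r = 0` the powers of `r` are bounded, so this is
integrable up to `r = 1`; multiplying back by `rⁿ` keeps continuity on `(0, 1]`. -/
theorem MemH1.exists_isRadialCoef (hu : MemH1 inside u) (m n : ℤ) :
    ∃ h, IsRadialCoef u m n h := by
  obtain ⟨vx, hvx, hx⟩ := hu.2 .x
  obtain ⟨vy, hvy, hy⟩ := hu.2 .y
  have h0 : Ioo (0 : ℝ) 1 ⊆ Ioi 0 := fun r hr => hr.1
  have hx' := hx.mono annulus_Ioo_subset_inside measurableSet_inside
  have hy' := hy.mono annulus_Ioo_subset_inside measurableSet_inside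
  set v : M → ℂ := fun p => vx p + (1 : ℤ) * Complex.I * vy p with hv
  have hvi : IntegrableOn v (annulus (Ioo 0 1)) :=
    (hvx.integrableOn_inside.add (hvy.integrableOn_inside.const_mul _)).mono_set
      annulus_Ioo_subset_inside
  have hW : LocallyIntegrableOn (fun r : ℝ => fourierCoef u m (1 * n) r * (r : ℂ) ^ (-n))
      (Ioo 0 1) :=
    (locallyIntegrableOn_fourierCoef isOpen_Ioo h0 hx'.locInt m _).mul_continuousOn
      (continuousOn_zpow_ofReal h0 _) isOpen_Ioo.isLocallyClosed
  have hV : ∀ r ∈ Ioo (0 : ℝ) 1,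
      IntegrableOn (fun s : ℝ => fourierCoef v m (1 * (n + 1)) s * (s : ℂ) ^ (-n)) (Ioo r 1) := by
    intro r hr
    have h1 := (integrableOn_mul_fourierCoef measurableSet_Ioo h0 hvi m (1 * (n + 1))).mono_set
      (Ioo_subset_Ioo_left hr.1.le : Ioo r 1 ⊆ Ioo 0 1)
    rw [← integrableOn_Icc_iff_integrableOn_Ioo] at h1 ⊢
    have hs : Icc r 1 ⊆ Ioi 0 := fun s hs => hr.1.trans_le hs.1
    refine (h1.mul_continuousOn (continuousOn_zpow_ofReal hs (-n - 1)) isCompact_Icc).congr_fun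
      (fun s hs' => ?_) measurableSet_Icc
    have hs0 : (s : ℂ) ≠ 0 := by exact_mod_cast (hs hs').ne'
    simp only [zpow_sub_one₀ hs0]
    field_simp
  obtain ⟨H, hH, hHe⟩ := exists_continuousOn_of_weak_deriv one_pos hW hV fun χ hχ =>
    weak_deriv_fourierCoef isOpen_Ioo h0 (Or.inl rfl) hx' hy' hχ m n
  refine ⟨fun r => H r * (r : ℂ) ^ n,
    hH.mul (continuousOn_zpow_ofReal (fun r hr => hr.1) n), ?_⟩
  filter_upwards [hHe, self_mem_ae_restrict measurableSet_Ioo] with r hr hr'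
  have hr0 : (r : ℂ) ≠ 0 := by exact_mod_cast (h0 hr').ne'
  rw [hr, mul_assoc, ← zpow_add₀ hr0, neg_add_cancel, zpow_zero, mul_one, one_mul]

/-- Null sets contain no interval. Limits along such filters are therefore unique, which is how
traces determine boundary values. -/
theorem neBot_inf_ae_of_Ioo {l : Filter ℝ}
    (h : ∀ s ∈ l, ∃ a b : ℝ, a < b ∧ Ioo a b ⊆ s) : (l ⊓ ae volume).NeBot := by
  rw [inf_neBot_iff]
  intro s hs t ht
  obtain ⟨a, b, hab, hsub⟩ := h s hs
  by_contra hne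
  rw [not_nonempty_iff_eq_empty] at hne
  have h1 : volume (Ioo a b) = 0 := by
    have hss : Ioo a b ⊆ tᶜ := by
      intro x hx hxt
      have : x ∈ s ∩ t := ⟨hsub hx, hxt⟩
      rw [hne] at this
      exact this
    exact measure_mono_null hss (mem_ae_iff.1 ht)
  rw [Real.volume_Ioo, ENNReal.ofReal_eq_zero] at h1
  linarith

instance neBot_nhdsGT_inf_ae : (𝓝[>] (1 : ℝ) ⊓ ae volume).NeBot :=
  neBot_inf_ae_of_Ioo fun _ hs => by
    obtain ⟨b, hb, hsub⟩ := mem_nhdsGT_iff_exists_Ioo_subset.1 hs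
    exact ⟨1, b, hb, hsub⟩

instance neBot_nhdsLT_inf_ae : (𝓝[<] (1 : ℝ) ⊓ ae volume).NeBot :=
  neBot_inf_ae_of_Ioo fun _ hs => by
    obtain ⟨a, ha, hsub⟩ := mem_nhdsLT_iff_exists_Ioo_subset.1 hs
    exact ⟨a, 1, ha, hsub⟩

/-- The boundary value of a continuous radial coefficient is the coefficient of the trace. -/
theorem IsRadialCoef.eq_torusCoef {h : ℝ → ℂ} {t : T2 → ℂ} {m n : ℤ} (hh : IsRadialCoef u m n h)
    (hu : MemH1 inside u) (ht : IsTrace (𝓝[<] 1) u t) : h 1 = torusCoef m n t := by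
  have h0 : Ioo (0 : ℝ) 1 ⊆ Ioi 0 := fun r hr => hr.1
  have hl : Ioo (0 : ℝ) 1 ∈ 𝓝[<] (1 : ℝ) := Ioo_mem_nhdsLT one_pos
  have h1 := tendsto_fourierCoef_of_isTrace measurableSet_Ioo h0 hl
    (hu.1.1.mono_set annulus_Ioo_subset_inside) ht m n
  have h2 : Tendsto h (𝓝[<] 1 ⊓ ae volume) (𝓝 (h 1)) := by
    have h3 : Tendsto h (𝓝[Ioc 0 1] 1) (𝓝 (h 1)) := hh.1 1 ⟨one_pos, le_rfl⟩
    refine (h3.mono_left ?_).mono_left inf_le_left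
    rw [← nhdsWithin_Ioo_eq_nhdsLT one_pos]
    exact nhdsWithin_mono _ Ioo_subset_Ioc_self
  refine tendsto_nhds_unique (h2.congr' ?_) h1
  have h4 := hh.2
  rw [ae_restrict_iff' measurableSet_Ioo] at h4
  filter_upwards [mem_inf_of_left hl, mem_inf_of_right h4] with r hr hr'
  exact hr' hr

end Weak

/-! ### The exterior solution: vanishing Wronskian and trace relations. -/

section Exterior

theorem contDiffOn_zpow_ofReal (k : ℤ) : ContDiffOn ℝ ∞ (fun r : ℝ => (r : ℂ) ^ k) (Ioi 0) := by
  intro r hr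
  have hr0 : (r : ℂ) ≠ 0 := by exact_mod_cast (ne_of_gt hr)
  have h2 : ContDiffAt ℝ ∞ (fun z : ℂ => z ^ k) (r : ℂ) :=
    ContDiffAt.restrict_scalars ℝ (𝕜' := ℂ) (((analyticAt_id (𝕜 := ℂ)).zpow hr0).contDiffAt)
  exact (h2.comp (f := fun r : ℝ => (r : ℂ)) r
    Complex.ofRealCLM.contDiff.contDiffAt).contDiffWithinAt

/-- A weak square integrable solution of the radial Dirac system on `(1, ∞)` has vanishing
Wronskian with a bounded enough classical solution `(α, β)` of the adjoint system. -/
theorem wronskian_eq_zero {m n : ℤ} {G Φ α β : ℝ → ℂ} {C : ℝ}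
    (hG : LocallyIntegrableOn G (Ioi 1)) (hΦ : LocallyIntegrableOn Φ (Ioi 1))
    (hGw : ∀ χ, IsTest (Ioi 1) χ → ∫ r in Ioi (1 : ℝ), G r * (r : ℂ) ^ (-n) * deriv χ r
      = m * ∫ r in Ioi (1 : ℝ), Φ r * (r : ℂ) ^ (-n) * χ r)
    (hΦw : ∀ χ, IsTest (Ioi 1) χ → ∫ r in Ioi (1 : ℝ), Φ r * (r : ℂ) ^ (n + 1) * deriv χ r
      = m * ∫ r in Ioi (1 : ℝ), G r * (r : ℂ) ^ (n + 1) * χ r)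
    (hG2 : IntegrableOn (fun r => r * ‖G r‖ ^ 2) (Ioi 1))
    (hΦ2 : IntegrableOn (fun r => r * ‖Φ r‖ ^ 2) (Ioi 1))
    (hα : ContDiffOn ℝ ∞ α (Ioi 0)) (hβ : ContDiffOn ℝ ∞ β (Ioi 0))
    (hαd : ∀ r : ℝ, 0 < r → HasDerivAt α (m * (r : ℂ) ^ (2 * n + 1) * β r) r)
    (hβd : ∀ r : ℝ, 0 < r → HasDerivAt β (m * (r : ℂ) ^ (-(2 * n + 1)) * α r) r)
    (hαb : ∀ r : ℝ, 1 < r → ‖(r : ℂ) ^ (-n) * α r‖ ^ 2 ≤ C * r)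
    (hβb : ∀ r : ℝ, 1 < r → ‖(r : ℂ) ^ (n + 1) * β r‖ ^ 2 ≤ C * r) :
    ∀ᵐ r ∂(volume.restrict (Ioi (1 : ℝ))),
      G r * ((r : ℂ) ^ (-n) * α r) + Φ r * ((r : ℂ) ^ (n + 1) * β r) = 0 := by
  have hsub : Ioi (1 : ℝ) ⊆ Ioi 0 := Ioi_subset_Ioi zero_le_one
  have hα' := hα.mono hsub
  have hβ' := hβ.mono hsub
  have hz : ∀ k : ℤ, ContDiffOn ℝ ∞ (fun r : ℝ => (r : ℂ) ^ k) (Ioi 1) := fun k =>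
    (contDiffOn_zpow_ofReal k).mono hsub
  have hloc : ∀ {W a : ℝ → ℂ}, LocallyIntegrableOn W (Ioi 1) → ContDiffOn ℝ ∞ a (Ioi 1) →
      LocallyIntegrableOn (fun r => W r * a r) (Ioi 1) := fun hW ha =>
    hW.mul_continuousOn ha.continuousOn isOpen_Ioi.isLocallyClosed
  have hGa := hloc hG ((hz (-n)).mul hα')
  have hΦb := hloc hΦ ((hz (n + 1)).mul hβ')
  obtain ⟨c, hc⟩ := ae_eq_const_of_integral_mul_deriv_eq_zero isOpen_Ioi ordConnected_Ioi
    nonempty_Ioi (hGa.add hΦb) fun χ hχ => by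
      -- The first equation is tested with `χ α`, the second with `χ β`. By the adjoint system the
      -- terms without `deriv χ` cancel in the sum.
      have hχα : IsTest (Ioi 1) (fun r => χ r * α r) := hχ.mul_contDiffOn isOpen_Ioi hα'
      have hχβ : IsTest (Ioi 1) (fun r => χ r * β r) := hχ.mul_contDiffOn isOpen_Ioi hβ'
      have hG' := hloc hG ((hz (n + 1)).mul hβ')
      have hΦ' := hloc hΦ ((hz (-n)).mul hα')
      have e1 : ∫ r in Ioi (1 : ℝ), G r * (r : ℂ) ^ (-n) * deriv (fun r => χ r * α r) r
          = (∫ r in Ioi (1 : ℝ), G r * ((r : ℂ) ^ (-n) * α r) * deriv χ r)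
            + m * ∫ r in Ioi (1 : ℝ), G r * ((r : ℂ) ^ (n + 1) * β r) * χ r := by
        rw [← integral_const_mul, ← integral_add (hχ.deriv.integrableOn_mul hGa)
          ((hχ.integrableOn_mul hG').const_mul _)]
        refine setIntegral_congr_fun measurableSet_Ioi fun r hr => ?_
        have hr0 : (r : ℂ) ≠ 0 := by exact_mod_cast (hsub hr).ne'
        have hp : (r : ℂ) ^ (n + 1) = (r : ℂ) ^ (-n) * (r : ℂ) ^ (2 * n + 1) := by
          rw [← zpow_add₀ hr0]; congr 1; ring
        have hd : deriv (fun r => χ r * α r) r = _ :=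
          ((hχ.hasDerivAt r).mul (hαd r (hsub hr))).deriv
        simp only [hd, hp]
        ring
      have e2 : ∫ r in Ioi (1 : ℝ), Φ r * (r : ℂ) ^ (n + 1) * deriv (fun r => χ r * β r) r
          = (∫ r in Ioi (1 : ℝ), Φ r * ((r : ℂ) ^ (n + 1) * β r) * deriv χ r)
            + m * ∫ r in Ioi (1 : ℝ), Φ r * ((r : ℂ) ^ (-n) * α r) * χ r := by
        rw [← integral_const_mul, ← integral_add (hχ.deriv.integrableOn_mul hΦb)
          ((hχ.integrableOn_mul hΦ').const_mul _)]
        refine setIntegral_congr_fun measurableSet_Ioi fun r hr => ?_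
        have hr0 : (r : ℂ) ≠ 0 := by exact_mod_cast (hsub hr).ne'
        have hp : (r : ℂ) ^ (-n) = (r : ℂ) ^ (n + 1) * (r : ℂ) ^ (-(2 * n + 1)) := by
          rw [← zpow_add₀ hr0]; congr 1; ring
        have hd : deriv (fun r => χ r * β r) r = _ :=
          ((hχ.hasDerivAt r).mul (hβd r (hsub hr))).deriv
        simp only [hd, hp]
        ring
      have e3 := hGw _ hχα
      have e4 := hΦw _ hχβ
      have e5 : ∫ r in Ioi (1 : ℝ), Φ r * (r : ℂ) ^ (-n) * (χ r * α r)
          = ∫ r in Ioi (1 : ℝ), Φ r * ((r : ℂ) ^ (-n) * α r) * χ r := by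
        congr 1; ext r; ring
      have e6 : ∫ r in Ioi (1 : ℝ), G r * (r : ℂ) ^ (n + 1) * (χ r * β r)
          = ∫ r in Ioi (1 : ℝ), G r * ((r : ℂ) ^ (n + 1) * β r) * χ r := by
        congr 1; ext r; ring
      rw [e1, e5] at e3
      rw [e2, e6] at e4
      simp only [Pi.add_apply, add_mul]
      rw [integral_add (hχ.deriv.integrableOn_mul hGa) (hχ.deriv.integrableOn_mul hΦb)]
      linear_combination e3 + e4
  -- A constant integrable on a half-line of infinite measure is zero, so an integrable bound for
  -- `|c|²` suffices.
  have hci : IntegrableOn (fun _ : ℝ => ‖c‖ ^ 2) (Ioi 1) := by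
    refine Integrable.mono' ((hG2.add hΦ2).const_mul (2 * C))
      aestronglyMeasurable_const ?_
    filter_upwards [hc, self_mem_ae_restrict measurableSet_Ioi] with r hr hr1
    rw [Real.norm_of_nonneg (by positivity), ← hr]
    simp only [Pi.add_apply]
    have h1 : ‖G r * ((r : ℂ) ^ (-n) * α r) + Φ r * ((r : ℂ) ^ (n + 1) * β r)‖
        ≤ ‖G r‖ * ‖(r : ℂ) ^ (-n) * α r‖ + ‖Φ r‖ * ‖(r : ℂ) ^ (n + 1) * β r‖ :=
      (norm_add_le _ _).trans_eq (by rw [norm_mul, norm_mul (Φ r)])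
    set A := ‖(r : ℂ) ^ (-n) * α r‖
    set B := ‖(r : ℂ) ^ (n + 1) * β r‖
    have h2 : ‖G r‖ ^ 2 * A ^ 2 ≤ ‖G r‖ ^ 2 * (C * r) := by gcongr; exact hαb r hr1
    have h3 : ‖Φ r‖ ^ 2 * B ^ 2 ≤ ‖Φ r‖ ^ 2 * (C * r) := by gcongr; exact hβb r hr1
    calc _ ≤ (‖G r‖ * A + ‖Φ r‖ * B) ^ 2 := by gcongr
      _ ≤ 2 * (‖G r‖ ^ 2 * A ^ 2 + ‖Φ r‖ ^ 2 * B ^ 2) := by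
          nlinarith [sq_nonneg (‖G r‖ * A - ‖Φ r‖ * B)]
      _ ≤ 2 * C * (r * ‖G r‖ ^ 2 + r * ‖Φ r‖ ^ 2) := by linarith
  have hc0 : c = 0 := by
    rw [integrableOn_const_iff (by simp)] at hci
    simpa using hci
  filter_upwards [hc] with r hr
  rw [hc0] at hr
  exact hr

variable {E : M → ℂ × ℂ} {w₁ w₂ : T2 → ℂ}

theorem outside_eq_annulus : outside = annulus (Ioi 1) := rfl

/-- The boundary condition satisfied by the trace of an exterior solution, for each classical
solution of the adjoint radial system that does not grow too fast. -/
theorem trace_relation (hD : IsDirac outside E fun _ => 0)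
    (hE₁ : MemL2 outside fun p => (E p).1) (hE₂ : MemL2 outside fun p => (E p).2)
    (ht₁ : IsTrace (𝓝[>] 1) (fun p => (E p).1) w₁) (ht₂ : IsTrace (𝓝[>] 1) (fun p => (E p).2) w₂)
    {m n : ℤ} {α β : ℝ → ℂ} {C : ℝ}
    (hα : ContDiffOn ℝ ∞ α (Ioi 0)) (hβ : ContDiffOn ℝ ∞ β (Ioi 0))
    (hαd : ∀ r : ℝ, 0 < r → HasDerivAt α (m * (r : ℂ) ^ (2 * n + 1) * β r) r)
    (hβd : ∀ r : ℝ, 0 < r → HasDerivAt β (m * (r : ℂ) ^ (-(2 * n + 1)) * α r) r)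
    (hαb : ∀ r : ℝ, 1 < r → ‖(r : ℂ) ^ (-n) * α r‖ ^ 2 ≤ C * r)
    (hβb : ∀ r : ℝ, 1 < r → ‖(r : ℂ) ^ (n + 1) * β r‖ ^ 2 ≤ C * r) :
    torusCoef m n w₂ * α 1 + torusCoef m (n + 1) w₁ * β 1 = 0 := by
  obtain ⟨df, dg, hdf, hdg, hae⟩ := hD
  rw [outside_eq_annulus] at *
  have hJ : IsOpen (Ioi (1 : ℝ)) := isOpen_Ioi
  have h0 : Ioi (1 : ℝ) ⊆ Ioi 0 := Ioi_subset_Ioi zero_le_one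
  have hae₁ : ∀ᵐ p ∂(volume.restrict (annulus (Ioi 1))),
      dg .x p + (1 : ℤ) * Complex.I * dg .y p = Complex.I * df .θ p := by
    filter_upwards [hae] with p hp
    have := hp.1
    simp only [Prod.fst_zero, one_div, Complex.inv_I] at this
    push_cast
    linear_combination -this
  have hae₂ : ∀ᵐ p ∂(volume.restrict (annulus (Ioi 1))),
      df .x p + (-1 : ℤ) * Complex.I * df .y p = Complex.I * dg .θ p := by
    filter_upwards [hae] with p hp
    have := hp.2
    simp only [Prod.snd_zero, one_div, Complex.inv_I] at this
    push_cast
    linear_combination this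
  have hG := locallyIntegrableOn_fourierCoef hJ h0 (hdg .x).locInt m n
  have hΦ := locallyIntegrableOn_fourierCoef hJ h0 (hdf .x).locInt m (n + 1)
  have hW := wronskian_eq_zero (m := m) (n := n) hG hΦ
    (fun χ hχ => by
      have := weak_deriv_fourierCoef_of_dirac hJ h0 (Or.inl rfl) (hdg .x) (hdg .y) (hdf .θ) hae₁
        hχ m n
      simpa only [one_mul] using this)
    -- With `ε = -1` the index `-(n + 1)` yields the coefficients at `n + 1` and `n` and the power
    -- `r ^ (n + 1)`.
    (fun χ hχ => by
      have := weak_deriv_fourierCoef_of_dirac hJ h0 (Or.inr rfl) (hdf .x) (hdf .y) (hdg .θ) hae₂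
        hχ m (-(n + 1))
      rw [show (-1 : ℤ) * -(n + 1) = n + 1 by ring, show (-1 : ℤ) * (-(n + 1) + 1) = n by ring]
        at this
      simpa only [neg_neg] using this)
    (integrableOn_mul_norm_sq_fourierCoef measurableSet_Ioi h0 hE₂ m n)
    (integrableOn_mul_norm_sq_fourierCoef measurableSet_Ioi h0 hE₁ m (n + 1))
    hα hβ hαd hβd hαb hβb
  have hl : Ioi (1 : ℝ) ∈ 𝓝[>] (1 : ℝ) := self_mem_nhdsWithin
  have hcont : ∀ a : ℝ → ℂ, ContinuousOn a (Ioi 0) →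
      Tendsto a (𝓝[>] 1 ⊓ ae volume) (𝓝 (a 1)) := fun a ha =>
    (ha.continuousAt (Ioi_mem_nhds one_pos)).tendsto.mono_left
      (inf_le_left.trans nhdsWithin_le_nhds)
  -- The Wronskian is followed to `r = 1⁺`, where all powers of `r` equal one.
  have hlim := ((tendsto_fourierCoef_of_isTrace measurableSet_Ioi h0 hl hE₂.1 ht₂ m n).mul
    (hcont _ ((contDiffOn_zpow_ofReal (-n)).continuousOn.mul hα.continuousOn))).add
    ((tendsto_fourierCoef_of_isTrace measurableSet_Ioi h0 hl hE₁.1 ht₁ m (n + 1)).mul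
    (hcont _ ((contDiffOn_zpow_ofReal (n + 1)).continuousOn.mul hβ.continuousOn)))
  have hzero : Tendsto (fun _ : ℝ => (0 : ℂ)) (𝓝[>] 1 ⊓ ae (volume : Measure ℝ)) (𝓝 0) :=
    tendsto_const_nhds
  have := tendsto_nhds_unique (hlim.congr' (by
    rw [ae_restrict_iff' measurableSet_Ioi] at hW
    filter_upwards [mem_inf_of_left hl, mem_inf_of_right hW] with r hr hr'
    exact hr' hr)) hzero
  simpa using this

theorem mul_exp_sub_one_le (t : ℝ) : t * Real.exp (-(t - 1)) ≤ 1 := by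
  have h := Real.add_one_le_exp (t - 1)
  rw [sub_add_cancel] at h
  calc t * Real.exp (-(t - 1)) ≤ Real.exp (t - 1) * Real.exp (-(t - 1)) := by gcongr
    _ = 1 := by rw [← Real.exp_add, add_neg_cancel, Real.exp_zero]

/-- This is the growth bound of `wronskian_eq_zero`. The assumption `μ ≥ 1`, true for `μ = |m|` with
`m` a nonzero integer, puts `μ r` in the range of `besselK_le`. -/
theorem mul_besselK_sq_le (n : ℤ) {μ r : ℝ} (hμ : 1 ≤ μ) (hr : 1 ≤ r) :
    (μ * r * besselK n (μ * r)) ^ 2 ≤ besselK n 1 ^ 2 * r := by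
  have ht : 1 ≤ μ * r := one_le_mul_of_one_le_of_one_le hμ hr
  have h1 : μ * r * besselK n (μ * r) ≤ besselK n 1 := by
    calc _ ≤ μ * r * (besselK n 1 * Real.exp (-(μ * r - 1))) := by
          gcongr; exact besselK_le n ht
      _ = besselK n 1 * (μ * r * Real.exp (-(μ * r - 1))) := by ring
      _ ≤ besselK n 1 * 1 := by
          gcongr
          · exact besselK_nonneg _ _
          · exact mul_exp_sub_one_le _
      _ = _ := mul_one _
  have h2 : 0 ≤ μ * r * besselK n (μ * r) := mul_nonneg (by linarith) (besselK_nonneg _ _)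
  calc _ ≤ besselK n 1 ^ 2 := by gcongr
    _ ≤ _ := le_mul_of_one_le_right (by positivity) hr

theorem hasDerivAt_zpow_ofReal (k : ℤ) {r : ℝ} (hr : 0 < r) :
    HasDerivAt (fun r : ℝ => (r : ℂ) ^ k) (k * (r : ℂ) ^ (k - 1)) r := by
  have hr0 : (r : ℂ) ≠ 0 := by exact_mod_cast hr.ne'
  exact (hasDerivAt_zpow k (r : ℂ) (Or.inl hr0)).comp_ofReal

theorem hasDerivAt_besselK_mul {k : ℤ} {μ r d : ℝ} (h : HasDerivAt (besselK k) d (μ * r)) :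
    HasDerivAt (fun r : ℝ => ((besselK k (μ * r) : ℝ) : ℂ)) ((μ * d : ℝ) : ℂ) r := by
  have h1 : HasDerivAt (fun r : ℝ => besselK k (μ * r)) (μ * d) r := by
    have h2 : HasDerivAt (fun r : ℝ => μ * r) μ r := by
      simpa using (hasDerivAt_id r).const_mul μ
    rw [mul_comm μ d]
    exact HasDerivAt.comp r h h2
  exact h1.ofReal_comp

theorem contDiffOn_besselK_mul (k : ℤ) {μ : ℝ} (hμ : 0 < μ) :
    ContDiffOn ℝ ∞ (fun r : ℝ => ((besselK k (μ * r) : ℝ) : ℂ)) (Ioi 0) := by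
  have h1 : ContDiffOn ℝ ∞ (fun r : ℝ => besselK k (μ * r)) (Ioi 0) :=
    (contDiffOn_besselK k).comp (contDiff_const.mul contDiff_id).contDiffOn
      fun r hr => mul_pos hμ hr
  exact Complex.ofRealCLM.contDiff.comp_contDiffOn h1

/-- Take `α = μ rⁿ⁺¹ K_{n+1}(μ r)` and `β = -m r⁻ⁿ K_n(μ r)` with `μ = |m|`. The ladder relations
and `μ² = m²` give the adjoint system, and at `r = 1` the powers disappear. -/
theorem trace_relation_besselK (hD : IsDirac outside E fun _ => 0)
    (hE₁ : MemL2 outside fun p => (E p).1) (hE₂ : MemL2 outside fun p => (E p).2)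
    (ht₁ : IsTrace (𝓝[>] 1) (fun p => (E p).1) w₁) (ht₂ : IsTrace (𝓝[>] 1) (fun p => (E p).2) w₂)
    {m : ℤ} (hm : m ≠ 0) (n : ℤ) :
    ((|(m : ℝ)| : ℝ) : ℂ) * ((besselK (n + 1) |(m : ℝ)| : ℝ) : ℂ) * torusCoef m n w₂
      - (m : ℂ) * ((besselK n |(m : ℝ)| : ℝ) : ℂ) * torusCoef m (n + 1) w₁ = 0 := by
  set μ : ℝ := |(m : ℝ)| with hμ
  have hμ1 : 1 ≤ μ := by
    rw [hμ, ← Int.cast_abs]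
    exact_mod_cast Int.one_le_abs hm
  have hμ0 : 0 < μ := by linarith
  have hμsq : (μ : ℂ) ^ 2 = (m : ℂ) ^ 2 := by
    have : μ ^ 2 = (m : ℝ) ^ 2 := sq_abs _
    exact_mod_cast congrArg ((↑) : ℝ → ℂ) this
  have hnm : ‖(m : ℂ)‖ = μ := by rw [Complex.norm_intCast]
  have h := trace_relation hD hE₁ hE₂ ht₁ ht₂ (m := m) (n := n)
    (α := fun r => μ * ((r : ℂ) ^ (n + 1) * ((besselK (n + 1) (μ * r) : ℝ) : ℂ)))
    (β := fun r => -m * ((r : ℂ) ^ (-n) * ((besselK n (μ * r) : ℝ) : ℂ)))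
    (C := besselK (n + 1) 1 ^ 2 + besselK n 1 ^ 2)
    (contDiffOn_const.mul ((contDiffOn_zpow_ofReal _).mul (contDiffOn_besselK_mul _ hμ0)))
    (contDiffOn_const.mul ((contDiffOn_zpow_ofReal _).mul (contDiffOn_besselK_mul _ hμ0)))
    ?_ ?_ ?_ ?_
  · simp only [Complex.ofReal_one, one_zpow, one_mul, mul_one] at h
    linear_combination h
  · intro r hr
    have hr0 : (r : ℂ) ≠ 0 := by exact_mod_cast hr.ne'
    have hμ' : (μ : ℂ) ≠ 0 := by exact_mod_cast hμ0.ne'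
    have hd := ((hasDerivAt_zpow_ofReal (n + 1) hr).mul
      (hasDerivAt_besselK_mul (hasDerivAt_besselK_add_one n (mul_pos hμ0 hr)))).const_mul (μ : ℂ)
    convert! hd using 1
    have e1 : (r : ℂ) ^ (2 * n + 1) * (r : ℂ) ^ (-n) = (r : ℂ) ^ (n + 1) := by
      rw [← zpow_add₀ hr0]; congr 1; ring
    have e2 : (r : ℂ) ^ (n + 1) = (r : ℂ) ^ n * r := zpow_add_one₀ hr0 n
    rw [add_sub_cancel_right]
    push_cast
    have e3 : (m : ℂ) * (r : ℂ) ^ (2 * n + 1)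
        * (-m * ((r : ℂ) ^ (-n) * ((besselK n (μ * r) : ℝ) : ℂ)))
        = -(μ : ℂ) ^ 2 * (r : ℂ) ^ (n + 1) * ((besselK n (μ * r) : ℝ) : ℂ) := by
      rw [hμsq, ← e1]; ring
    rw [e3, e2]
    field_simp
    ring
  · intro r hr
    have hr0 : (r : ℂ) ≠ 0 := by exact_mod_cast hr.ne'
    have hμ' : (μ : ℂ) ≠ 0 := by exact_mod_cast hμ0.ne'
    have hd := ((hasDerivAt_zpow_ofReal (-n) hr).mul
      (hasDerivAt_besselK_mul (hasDerivAt_besselK_sub n (mul_pos hμ0 hr)))).const_mul (-m : ℂ)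
    convert! hd using 1
    have e1 : (r : ℂ) ^ (-(2 * n + 1)) * (r : ℂ) ^ (n + 1) = (r : ℂ) ^ (-n) := by
      rw [← zpow_add₀ hr0]; congr 1; ring
    have e2 : (r : ℂ) ^ (-n) = (r : ℂ) ^ (-n - 1) * r := by
      rw [← zpow_add_one₀ hr0]; congr 1; ring
    push_cast
    have e3 : (m : ℂ) * (r : ℂ) ^ (-(2 * n + 1))
        * (μ * ((r : ℂ) ^ (n + 1) * ((besselK (n + 1) (μ * r) : ℝ) : ℂ)))
        = m * μ * (r : ℂ) ^ (-n) * ((besselK (n + 1) (μ * r) : ℝ) : ℂ) := by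
      rw [← e1]; ring
    rw [e3, e2]
    field_simp
    ring
  · intro r hr
    have hr0 : (r : ℂ) ≠ 0 := by exact_mod_cast (zero_lt_one.trans hr).ne'
    have e1 : (r : ℂ) ^ (-n) * (μ * ((r : ℂ) ^ (n + 1) * ((besselK (n + 1) (μ * r) : ℝ) : ℂ)))
        = ((μ * r * besselK (n + 1) (μ * r) : ℝ) : ℂ) := by
      have : (r : ℂ) ^ (-n) * (r : ℂ) ^ (n + 1) = r := by
        rw [← zpow_add₀ hr0]; simp
      push_cast
      linear_combination (μ * ((besselK (n + 1) (μ * r) : ℝ) : ℂ)) * this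
    rw [e1, Complex.norm_real, Real.norm_eq_abs, sq_abs]
    refine (mul_besselK_sq_le _ hμ1 hr.le).trans ?_
    have : 0 ≤ besselK n 1 ^ 2 * r := by positivity
    linarith
  · intro r hr
    have hr0 : (r : ℂ) ≠ 0 := by exact_mod_cast (zero_lt_one.trans hr).ne'
    have e1 : ‖(r : ℂ) ^ (n + 1) * (-m * ((r : ℂ) ^ (-n) * ((besselK n (μ * r) : ℝ) : ℂ)))‖
        = |μ * r * besselK n (μ * r)| := by
      have h1 : (r : ℂ) ^ (n + 1) * (r : ℂ) ^ (-n) = r := by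
        rw [← zpow_add₀ hr0]; simp
      have h2 : (r : ℂ) ^ (n + 1) * (-m * ((r : ℂ) ^ (-n) * ((besselK n (μ * r) : ℝ) : ℂ)))
          = -(m * (((r * besselK n (μ * r) : ℝ) : ℂ))) := by
        push_cast
        linear_combination (-m * ((besselK n (μ * r) : ℝ) : ℂ)) * h1
      rw [h2, norm_neg, norm_mul, hnm, Complex.norm_real, Real.norm_eq_abs, mul_assoc, abs_mul μ,
        abs_of_pos hμ0]
    rw [e1, sq_abs]
    refine (mul_besselK_sq_le _ hμ1 hr.le).trans ?_
    have : 0 ≤ besselK (n + 1) 1 ^ 2 * r := by positivity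
    linarith

theorem norm_zpow_sq_le {r : ℝ} (hr : 1 < r) {k : ℤ} (hk : k ≤ 0) :
    ‖(r : ℂ) ^ k‖ ^ 2 ≤ 1 * r := by
  have h1 : ‖(r : ℂ) ^ k‖ ≤ 1 := by
    rw [norm_zpow, Complex.norm_real, Real.norm_of_nonneg (by linarith)]
    exact zpow_le_one_of_nonpos₀ hr.le hk
  calc _ ≤ (1 : ℝ) ^ 2 := by gcongr
    _ ≤ _ := by linarith

/-- For `m = 0` the adjoint system says that `α` and `β` are constant. The pair `(1, 0)` meets the
growth bound when `n ≥ 0`, as then `r⁻ⁿ ≤ 1` for `r > 1`. -/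
theorem trace_snd_zero_eq_zero (hD : IsDirac outside E fun _ => 0)
    (hE₁ : MemL2 outside fun p => (E p).1) (hE₂ : MemL2 outside fun p => (E p).2)
    (ht₁ : IsTrace (𝓝[>] 1) (fun p => (E p).1) w₁) (ht₂ : IsTrace (𝓝[>] 1) (fun p => (E p).2) w₂)
    {n : ℤ} (hn : 0 ≤ n) : torusCoef 0 n w₂ = 0 := by
  have h := trace_relation hD hE₁ hE₂ ht₁ ht₂ (m := 0) (n := n) (C := 1)
    (α := fun _ => 1) (β := fun _ => 0) contDiffOn_const contDiffOn_const
    (fun r _ => by simpa using hasDerivAt_const r (1 : ℂ))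
    (fun r _ => by simpa using hasDerivAt_const r (0 : ℂ))
    (fun r hr => by rw [mul_one]; exact norm_zpow_sq_le hr (by linarith))
    (fun r hr => by rw [mul_zero, norm_zero]; norm_num; linarith)
  simpa using h

theorem trace_fst_zero_eq_zero (hD : IsDirac outside E fun _ => 0)
    (hE₁ : MemL2 outside fun p => (E p).1) (hE₂ : MemL2 outside fun p => (E p).2)
    (ht₁ : IsTrace (𝓝[>] 1) (fun p => (E p).1) w₁) (ht₂ : IsTrace (𝓝[>] 1) (fun p => (E p).2) w₂)
    {n : ℤ} (hn : n ≤ 0) : torusCoef 0 n w₁ = 0 := by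
  -- The first component enters `trace_relation` at `n + 1`, hence the shift to `n - 1`; the pair
  -- `(0, 1)` then needs `rⁿ` bounded.
  have h := trace_relation hD hE₁ hE₂ ht₁ ht₂ (m := 0) (n := n - 1) (C := 1)
    (α := fun _ => 0) (β := fun _ => 1) contDiffOn_const contDiffOn_const
    (fun r _ => by simpa using hasDerivAt_const r (0 : ℂ))
    (fun r _ => by simpa using hasDerivAt_const r (1 : ℂ))
    (fun r hr => by rw [mul_zero, norm_zero]; norm_num; linarith)
    (fun r hr => by rw [mul_one]; exact norm_zpow_sq_le hr (by linarith))
  simpa using h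

end Exterior

end SolidTorus

open SolidTorus
theorem mainTheorem6 (F : M → ℂ × ℂ) (hF : F ∈ diracDomain) :
    (∀ m n : ℤ, (∃ h : ℝ → ℂ, IsRadialCoef (fun p => (F p).1) m n h) ∧
      ∃ h : ℝ → ℂ, IsRadialCoef (fun p => (F p).2) m n h) ∧
    ∀ f g : ℤ → ℤ → ℝ → ℂ,
      (∀ m n : ℤ, IsRadialCoef (fun p => (F p).1) m n (f m n)) →
      (∀ m n : ℤ, IsRadialCoef (fun p => (F p).2) m n (g m n)) →
      (∀ m n : ℤ, m ≠ 0 →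
        ((|(m : ℝ)| : ℝ) : ℂ) * ((besselK (n + 1) |(m : ℝ)| : ℝ) : ℂ) * g m n 1
          - (m : ℂ) * ((besselK n |(m : ℝ)| : ℝ) : ℂ) * f m (n + 1) 1 = 0) ∧
      (∀ n : ℤ, n ≤ 0 → f 0 n 1 = 0) ∧
      (∀ n : ℤ, 0 ≤ n → g 0 n 1 = 0) := by
  obtain ⟨hF₁, hF₂, E, -, ⟨w₁, w₂, ⟨hi₁, ho₁⟩, hi₂, ho₂⟩, hD, hE₁, hE₂⟩ := hF
  refine ⟨fun m n => ⟨hF₁.exists_isRadialCoef m n, hF₂.exists_isRadialCoef m n⟩,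
    fun f g hf hg => ⟨fun m n hm => ?_, fun n hn => ?_, fun n hn => ?_⟩⟩
  -- The interior and the exterior share the traces `w₁` and `w₂`, so the exterior relations
  -- transfer to the interior boundary values.
  · rw [(hg m n).eq_torusCoef hF₂ hi₂, (hf m (n + 1)).eq_torusCoef hF₁ hi₁]
    exact trace_relation_besselK hD hE₁ hE₂ ho₁ ho₂ hm n
  · rw [(hf 0 n).eq_torusCoef hF₁ hi₁]
    exact trace_fst_zero_eq_zero hD hE₁ hE₂ ho₁ ho₂ hn
  · rw [(hg 0 n).eq_torusCoef hF₂ hi₂]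
    exact trace_snd_zero_eq_zero hD hE₁ hE₂ ho₁ ho₂ hn
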